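/- Let $\mathcal C$ be a finite nonempty set of candidates and $\mathcal V$ a finite nonempty set of voters. A vote is a linear order on $\mathcal C$, and a profile $P$ assigns a vote to each voter. For candidates $a\neq b$ let $D_P(a,b)$ be the number of voters who prefer $a$ to $b$ minus the number of voters who prefer $b$ to $a$. The maximin score of $a$ is $\min_{b\ne a}D_P(a,b)$ (with $\min\emptyset=+\infty$). The maximin rule $r$ selects, among the candidates of maximum maximin score, the one ranked highest by a given tie-breaking linear order $\succ_t$ on $\mathcal C$. Let $x=r(P)$ be the current winner. A set $M\subseteq\mathcal V$ is a coalition of possible manipulators against a candidate $y$ if $y\ne x$ and there are votes $(\succ'_j)_{j\in M}$ with $x\succ'_j y$ for all $j\in M$ such that $y$ wins under $r$ in the profile obtained from $P$ by replacing the vote of each $j\in M$ by $\succ'_j$. The set $M$ is a coalition of possible manipulators if it is one against some candidate. Consider the following decision problems, in which the input always contains $\mathcal C$, $\mathcal V$, the profile $P$ and the tie-breaking order $\succ_t$: - CPMW: given also $M\subseteq\mathcal V$ and $y\in\mathcal C$, is $M$ a coalition of possible manipulators against $y$? - CPM: given also $M\subseteq\mathcal V$, is $M$ a coalition of possible manipulators?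 - CPMSW: given also $y\in\mathcal C$ and a number $k$, is there $M\subseteq\mathcal V$ with $|M|\le k$ that is a coalition of possible manipulators against $y$? - CPMS: given also a number $k$, is there $M\subseteq\mathcal V$ with $|M|\le k$ that is a coalition of possible manipulators? **Theorem.** For the maximin voting rule, the problems CPMW and CPM restricted to instances with $|M|=1$, and the problems CPMSW and CPMS restricted to instances with $k=1$, are in $\mathsf P$. That is, for each of these four problems, the set of binary encodings of its yes-instances is decided by a Turing machine in time polynomial in the length of the input string. -/

import Mathlib

namespace PossibleManipulators

/-! ### Votes, profiles, voting rules -/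

/-- A linear order on the candidate set `Fin m`, given as the ranking that lists the candidates
from best to worst: `v p` is the candidate at position `p`, and position `0` is the top. -/
abbrev Vote (m : ℕ) : Type := Equiv.Perm (Fin m)

/-- `a` is strictly preferred to `b` in the vote `v`. -/
def Vote.Prefers {m : ℕ} (v : Vote m) (a b : Fin m) : Prop := v.symm a < v.symm b

instance {m : ℕ} (v : Vote m) (a b : Fin m) : Decidable (v.Prefers a b) :=
  inferInstanceAs (Decidable (v.symm a < v.symm b))

/-- A preference profile: one vote for each of the `n` voters. -/
abbrev Profile (m n : ℕ) : Type := Fin n → Vote m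

/-- A voting correspondence assigns to every profile (with at least one candidate and at least one
voter) a nonempty set of winning candidates. -/
abbrev VotingCorrespondence : Type :=
  ∀ (m n : ℕ) [NeZero m] [NeZero n], Profile m n → {S : Finset (Fin m) // S.Nonempty}

/-- Lexicographic tie breaking: the member of `S` that the tie-breaking order `t` ranks highest. -/
def tieBreak {m : ℕ} (t : Vote m) (S : {S : Finset (Fin m) // S.Nonempty}) : Fin m :=
  t ((S.1.image t.symm).min' (S.2.image t.symm))

/-- The voting rule obtained from a voting correspondence and a lexicographic tie-breaking order. -/
def winner (F : VotingCorrespondence) {m n : ℕ} [NeZero m] [NeZero n] (t : Vote m)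
    (P : Profile m n) : Fin m :=
  tieBreak t (F m n P)

/-! ### The maximin voting correspondence -/

/-- The number of voters who prefer `a` to `b`. -/
def numPrefer {m n : ℕ} (P : Profile m n) (a b : Fin m) : ℕ :=
  (Finset.univ.filter fun i => (P i).Prefers a b).card

/-- The weight of the edge `(a, b)` in the weighted majority graph. -/
def margin {m n : ℕ} (P : Profile m n) (a b : Fin m) : ℤ :=
  (numPrefer P a b : ℤ) - (numPrefer P b a : ℤ)

/-- The maximin score of `a`: the minimum of `margin P a b` over all `b ≠ a`
(`⊤` when `a` is the only candidate). -/
def maximinScore {m n : ℕ} (P : Profile m n) (a : Fin m) : WithTop ℤ :=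
  (Finset.univ.erase a).inf fun b => ((margin P a b : ℤ) : WithTop ℤ)

/-- The candidates with maximum maximin score. -/
def maximinWinners {m n : ℕ} (P : Profile m n) : Finset (Fin m) :=
  Finset.univ.filter fun a => ∀ b, maximinScore P b ≤ maximinScore P a

theorem maximinWinners_nonempty {m n : ℕ} [NeZero m] (P : Profile m n) :
    (maximinWinners P).Nonempty := by
  obtain ⟨a, -, ha⟩ := Finset.exists_max_image (Finset.univ : Finset (Fin m)) (maximinScore P)
    ⟨0, Finset.mem_univ _⟩
  exact ⟨a, Finset.mem_filter.2 ⟨Finset.mem_univ _, fun b => ha b (Finset.mem_univ _)⟩⟩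

def maximin : VotingCorrespondence :=
  fun _ _ _ _ P => ⟨maximinWinners P, maximinWinners_nonempty P⟩

/-! ### Coalitions of possible manipulators -/

/-- The profile in which the voters in `M` vote according to `Q` and all others according to `P`. -/
def replaceVotes {m n : ℕ} (P : Profile m n) (M : Finset (Fin n)) (Q : M → Vote m) :
    Profile m n :=
  fun i => if h : i ∈ M then Q ⟨i, h⟩ else P i

/-- `M` is a coalition of possible manipulators against `y` with respect to the voting rule `r`. -/
def IsCoalitionAgainst {m n : ℕ} (r : Profile m n → Fin m) (P : Profile m n)
    (M : Finset (Fin n)) (y : Fin m) : Prop :=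
  y ≠ r P ∧ ∃ Q : M → Vote m,
    (∀ j, (Q j).Prefers (r P) y) ∧ r (replaceVotes P M Q) = y

/-- `M` is a coalition of possible manipulators with respect to the voting rule `r`. -/
def IsCoalition {m n : ℕ} (r : Profile m n → Fin m) (P : Profile m n)
    (M : Finset (Fin n)) : Prop :=
  ∃ y, IsCoalitionAgainst r P M y

/-! ### Decision problems and the class P -/

/-- A decision problem: a type of instances, an injective encoding of the instances by binary
strings, and the set of yes-instances. -/
structure DecisionProblem where
  Inst : Type
  encode : Inst → List Bool
  encode_injective : Function.Injective encode
  Yes : Inst → Prop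

/-- The language of the encodings of the yes-instances. -/
def DecisionProblem.language (p : DecisionProblem) : Language Bool :=
  {w | ∃ I : p.Inst, p.Yes I ∧ p.encode I = w}

/-- The restriction of a decision problem to the instances that satisfy `c`. -/
def DecisionProblem.restrict (p : DecisionProblem) (c : p.Inst → Prop) : DecisionProblem where
  Inst := {I : p.Inst // c I}
  encode I := p.encode I.1
  encode_injective := p.encode_injective.comp Subtype.val_injective
  Yes I := p.Yes I.1

open Classical in
/-- The class P: some Turing machine decides, for every binary string, whether it belongs to the
language, in time polynomial in the length of the string. -/
def LanguageInP (L : Language Bool) : Prop :=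
  Nonempty (Turing.TM2ComputableInPolyTime (id : List Bool → List Bool) Computability.encodeBool
    (fun w => decide (w ∈ L)))

def DecisionProblem.InP (p : DecisionProblem) : Prop := LanguageInP p.language

/-! ### Encoding of elections

A natural number `j` is written as `j` ones followed by a zero. For candidates and voters this
unary notation makes no difference to polynomial time: every instance lists, for each of its voters,
all of its candidates, so its length is at least the number of voters and of candidates in any
reasonable encoding. The bound `k` is used only with the fixed value `1`. -/

def encodeNats (l : List ℕ) : List Bool :=
  l.flatMap fun j => List.replicate j true ++ [false]

theorem encodeNats_injective : Function.Injective encodeNats := by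
  have key : ∀ (a b : ℕ) (s t : List Bool),
      List.replicate a true ++ false :: s = List.replicate b true ++ false :: t →
        a = b ∧ s = t := by
    intro a
    induction a with
    | zero =>
      intro b s t h
      cases b with
      | zero => simpa using h
      | succ b => simp [List.replicate_succ] at h
    | succ a ih =>
      intro b s t h
      cases b with
      | zero => simp [List.replicate_succ] at h
      | succ b =>
        obtain ⟨h1, h2⟩ := ih b s t (by simpa [List.replicate_succ] using h)
        exact ⟨by omega, h2⟩
  intro l
  induction l with
  | nil =>
    intro l' h
    cases l' with
    | nil => rfl
    | cons b t => simp [encodeNats] at h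
  | cons a s ih =>
    intro l' h
    cases l' with
    | nil => simp [encodeNats] at h
    | cons b t =>
      obtain ⟨h1, h2⟩ := key a b (encodeNats s) (encodeNats t) (by simpa [encodeNats] using h)
      rw [h1, ih h2]

/-- The candidates, from best to worst. -/
def Vote.code {m : ℕ} (v : Vote m) : List ℕ := List.ofFn fun p => (v p : ℕ)

theorem Vote.code_injective {m : ℕ} : Function.Injective (Vote.code : Vote m → List ℕ) := by
  intro v w h
  have h1 := List.ofFn_injective h
  exact Equiv.ext fun p => Fin.ext (congrFun h1 p)

/-- An election: `m ≥ 1` candidates, `n ≥ 1` voters, their votes, and the order that the voting rule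
uses for breaking ties. -/
structure Election where
  m : ℕ
  n : ℕ
  [m_ne_zero : NeZero m]
  [n_ne_zero : NeZero n]
  tie : Vote m
  votes : Profile m n

attribute [instance] Election.m_ne_zero Election.n_ne_zero

/-- The numbers of candidates and voters, then the tie-breaking order, then all votes. -/
def Election.code (E : Election) : List ℕ :=
  [E.m, E.n] ++ E.tie.code ++ (List.ofFn fun i => (E.votes i).code).flatten

theorem Election.code_append_inj {E E' : Election} {s s' : List ℕ}
    (h : E.code ++ s = E'.code ++ s') : E = E' ∧ s = s' := by
  obtain ⟨m, n, t, P⟩ := E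
  obtain ⟨m', n', t', P'⟩ := E'
  simp only [Election.code, List.cons_append, List.nil_append, List.cons.injEq,
    List.append_assoc] at h
  obtain ⟨rfl, rfl, h⟩ := h
  obtain ⟨h1, h2⟩ := List.append_inj h (by simp [Vote.code])
  obtain rfl := Vote.code_injective h1
  have hl : ∀ Q : Profile m n, (List.ofFn fun i => (Q i).code).flatten.length = n * m := by
    intro Q
    simp [List.length_flatten, List.map_ofFn, Function.comp_def, Vote.code]
  obtain ⟨h3, h4⟩ := List.append_inj h2 (by rw [hl, hl])
  have h5 : (List.ofFn fun i => (P i).code) = List.ofFn fun i => (P' i).code := by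
    apply List.eq_iff_flatten_eq.2
    refine ⟨h3, ?_⟩
    simp [List.map_ofFn, Function.comp_def, Vote.code]
  have h6 := List.ofFn_injective h5
  obtain rfl : P = P' := funext fun i => Vote.code_injective (congrFun h6 i)
  exact ⟨rfl, h4⟩

/-- The winner of the election. -/
def Election.winner (F : VotingCorrespondence) (E : Election) (P : Profile E.m E.n) : Fin E.m :=
  PossibleManipulators.winner F E.tie P

/-- A set of voters as its indicator vector. -/
def coalitionCode {n : ℕ} (M : Finset (Fin n)) : List ℕ :=
  List.ofFn fun i => if i ∈ M then 1 else 0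

theorem coalitionCode_injective {n : ℕ} :
    Function.Injective (coalitionCode : Finset (Fin n) → List ℕ) := by
  intro M M' h
  have h1 := List.ofFn_injective h
  ext i
  have h2 := congrFun h1 i
  by_cases a : i ∈ M <;> by_cases b : i ∈ M' <;> simp_all

/-! ### The four problems -/

structure CPMWInstance extends Election where
  M : Finset (Fin n)
  y : Fin m

structure CPMInstance extends Election where
  M : Finset (Fin n)

structure CPMSWInstance extends Election where
  y : Fin m
  k : ℕ

structure CPMSInstance extends Election where
  k : ℕ

/-- Coalitional Possible Manipulators given Winner. -/
def CPMW (F : VotingCorrespondence) : DecisionProblem where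
  Inst := CPMWInstance
  encode I := encodeNats (I.code ++ (coalitionCode I.M ++ [(I.y : ℕ)]))
  encode_injective := by
    intro I J h
    obtain ⟨h1, h2⟩ := Election.code_append_inj (encodeNats_injective h)
    obtain ⟨E, M, y⟩ := I
    obtain ⟨E', M', y'⟩ := J
    obtain rfl : E = E' := h1
    obtain ⟨h3, h4⟩ := List.append_inj h2 (by simp [coalitionCode])
    obtain rfl : M = M' := coalitionCode_injective h3
    obtain rfl : y = y' := Fin.ext (by simpa using h4)
    rfl
  Yes I := IsCoalitionAgainst (I.winner F) I.votes I.M I.y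

/-- Coalitional Possible Manipulators. -/
def CPM (F : VotingCorrespondence) : DecisionProblem where
  Inst := CPMInstance
  encode I := encodeNats (I.code ++ coalitionCode I.M)
  encode_injective := by
    intro I J h
    obtain ⟨h1, h2⟩ := Election.code_append_inj (encodeNats_injective h)
    obtain ⟨E, M⟩ := I
    obtain ⟨E', M'⟩ := J
    obtain rfl : E = E' := h1
    obtain rfl : M = M' := coalitionCode_injective h2
    rfl
  Yes I := IsCoalition (I.winner F) I.votes I.M

/-- Coalitional Possible Manipulators Search given Winner. -/
def CPMSW (F : VotingCorrespondence) : DecisionProblem where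
  Inst := CPMSWInstance
  encode I := encodeNats (I.code ++ [(I.y : ℕ), I.k])
  encode_injective := by
    intro I J h
    obtain ⟨h1, h2⟩ := Election.code_append_inj (encodeNats_injective h)
    obtain ⟨E, y, k⟩ := I
    obtain ⟨E', y', k'⟩ := J
    obtain rfl : E = E' := h1
    simp only [List.cons.injEq, and_true] at h2
    obtain rfl : y = y' := Fin.ext h2.1
    obtain rfl : k = k' := h2.2
    rfl
  Yes I := ∃ M : Finset (Fin I.n), M.card ≤ I.k ∧
    IsCoalitionAgainst (I.winner F) I.votes M I.y

/-- Coalitional Possible Manipulators Search. -/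
def CPMS (F : VotingCorrespondence) : DecisionProblem where
  Inst := CPMSInstance
  encode I := encodeNats (I.code ++ [I.k])
  encode_injective := by
    intro I J h
    obtain ⟨h1, h2⟩ := Election.code_append_inj (encodeNats_injective h)
    obtain ⟨E, k⟩ := I
    obtain ⟨E', k'⟩ := J
    obtain rfl : E = E' := h1
    obtain rfl : k = k' := by simpa using h2
    rfl
  Yes I := ∃ M : Finset (Fin I.n), M.card ≤ I.k ∧ IsCoalition (I.winner F) I.votes M

end PossibleManipulators

/-! A single manipulator `j` who wants `y` to win can be handled greedily. Fix the minimum pairwise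
count `s` that `y` is to reach. Then `y` wins exactly if every pairwise count of `y` is at least `s`
and every other `b` has some pairwise count below `s`, or below `s + 1` if ties between `y` and `b`
go to `y` (`winner_maximin_eq_iff_exists`). The vote of `j` adds 0 or 1 to each count
(`numPrefer_update`), so these conditions, together with `x` above `y`, are conditions on each
candidate separately, and they depend only on the set of candidates ranked above it. They are
monotone: a larger set above a candidate never hurts it. Hence it is safe to fill the vote from the
top and to place, in each round, all candidates whose conditions hold. A suitable vote exists if and
only if all candidates are placed within `m` rounds and no count of `y` falls short of `s` by more
than 1 (`exists_vote_iff_placed`). Trying all `s ≤ n` decides whether `{j}` is a coalition against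
`y` (`isCoalitionAgainst_singleton_iff`). For the search problems with `k = 1` one tries all voters,
since the empty coalition changes nothing (`exists_isCoalitionAgainst_iff`); where `y` is not given
one tries all candidates.

That this runs in polynomial time on a Turing machine is shown through a small language of stack
programs, in which one execution step is one machine step (`Prog.steps_code`). The functions with
polynomial-time programs (`PT`) are closed under composition, pairing, case distinction and
iteration with polynomially bounded intermediate results (`PT.foldl`). Numbers are held in unary, so
arithmetic and bounded quantifiers come from iteration, and the algorithm is in the class by its
mere syntactic form.

It remains to link strings and elections. `isCode_iff` recognizes the strings that encode an
election followed by a given number of parameters, so that malformed inputs are rejected, and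
`Describes.manip_iff` shows that on encodings the test computed from the string is the intended one.
-/

namespace PossibleManipulators

/-! ### Structured programs on stacks -/

/-- Structured programs that work on stacks of bits indexed by `K`. -/
inductive Prog (K : Type) : Type
  | nop : Prog K
  | push : K → Bool → Prog K
  | pop : K → Prog K
  | seq : Prog K → Prog K → Prog K
  /-- Run the first program if the top of the stack is `true`, otherwise the second one. -/
  | ite : K → Prog K → Prog K → Prog K
  /-- While the stack is nonempty, pop its top and run the first program if it was `true` and
  the second one if it was `false`. -/
  | drain : K → Prog K → Prog K → Prog K

/-- The contents of the stacks. -/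
abbrev Stacks (K : Type) : Type := K → List Bool

open Classical in
/-- Replace the content of one stack. -/
noncomputable def Stacks.set {K : Type} (R : Stacks K) (k : K) (l : List Bool) : Stacks K :=
  Function.update R k l

@[simp] theorem Stacks.set_same {K : Type} (R : Stacks K) (k : K) (l : List Bool) :
    R.set k l k = l := by
  simp [Stacks.set]

theorem Stacks.set_of_ne {K : Type} (R : Stacks K) {k k' : K} (h : k' ≠ k) (l : List Bool) :
    R.set k l k' = R k' := by
  simp [Stacks.set, h]

open Classical in
theorem Stacks.set_apply {K : Type} (R : Stacks K) (k k' : K) (l : List Bool) :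
    R.set k l k' = if k' = k then l else R k' := by
  simp [Stacks.set, Function.update_apply]

theorem Stacks.set_eq {K : Type} {R S : Stacks K} {k : K} {l : List Bool} (h : S k = l)
    (h' : ∀ k', k' = k ∨ S k' = R k') : R.set k l = S := by
  funext k'
  by_cases hk : k' = k
  · rw [hk, set_same, h]
  · rw [set_of_ne _ hk, (h' k').resolve_left hk]

/-- `Exec p R n R'`: started with the stacks `R`, the program `p` terminates after `n` steps with
the stacks `R'`. -/
inductive Exec {K : Type} : Prog K → Stacks K → ℕ → Stacks K → Prop
  | nop (R) : Exec .nop R 1 R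
  | push (k b R) : Exec (.push k b) R 1 (R.set k (b :: R k))
  | pop (k R) : Exec (.pop k) R 1 (R.set k (R k).tail)
  | seq {p q R n R' n' R''} : Exec p R n R' → Exec q R' n' R'' → Exec (.seq p q) R (n + n') R''
  | ite_true {k p q R n R'} : (R k).head? = some true → Exec p R n R' →
      Exec (.ite k p q) R (1 + n) R'
  | ite_false {k p q R n R'} : (R k).head? ≠ some true → Exec q R n R' →
      Exec (.ite k p q) R (1 + n) R'
  | drain_nil {k p q R} : R k = [] → Exec (.drain k p q) R 1 R
  | drain_true {k p q R l n R' n' R''} : R k = true :: l → Exec p (R.set k l) n R' →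
      Exec (.drain k p q) R' n' R'' → Exec (.drain k p q) R (1 + n + n') R''
  | drain_false {k p q R l n R' n' R''} : R k = false :: l → Exec q (R.set k l) n R' →
      Exec (.drain k p q) R' n' R'' → Exec (.drain k p q) R (1 + n + n') R''

/-- A step pushes at most one bit. Running time therefore bounds output size, which is what makes
compositions polynomial. -/
theorem Exec.length_le {K : Type} {p : Prog K} {R R' : Stacks K} {n : ℕ} (h : Exec p R n R')
    (k : K) : (R' k).length ≤ (R k).length + n := by
  induction h with
  | nop R => omega
  | push k' b R =>
    rw [Stacks.set_apply]
    split_ifs with h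
    · subst h; simp
    · omega
  | pop k' R =>
    rw [Stacks.set_apply]
    split_ifs with h
    · subst h; simp; omega
    · omega
  | seq _ _ h1 h2 => omega
  | ite_true _ _ h | ite_false _ _ h => omega
  | drain_nil => omega
  | drain_true hl _ _ h1 h2 | drain_false hl _ _ h1 h2 =>
    rw [Stacks.set_apply] at h1
    split_ifs at h1 with h
    · subst h
      rw [hl, List.length_cons]
      omega
    · omega

/-- Rename the stacks of a program. -/
def Prog.map {K K' : Type} (e : K → K') : Prog K → Prog K'
  | .nop => .nop
  | .push k b => .push (e k) b
  | .pop k => .pop (e k)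
  | .seq p q => .seq (p.map e) (q.map e)
  | .ite k p q => .ite (e k) (p.map e) (q.map e)
  | .drain k p q => .drain (e k) (p.map e) (q.map e)

theorem Stacks.extend_set {K K' : Type} {e : K → K'} (he : e.Injective) (R : Stacks K)
    (S : Stacks K') (k : K) (l : List Bool) :
    Stacks.set (Function.extend e R S) (e k) l = Function.extend e (R.set k l) S := by
  funext k'
  rw [Stacks.set_apply]
  by_cases h : ∃ k₀, e k₀ = k'
  · obtain ⟨k₀, rfl⟩ := h
    rw [he.extend_apply, he.extend_apply, Stacks.set_apply]
    by_cases hk : k₀ = k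
    · rw [if_pos hk, if_pos (congrArg e hk)]
    · rw [if_neg hk, if_neg (he.ne hk)]
  · rw [Function.extend_apply' _ _ _ h, Function.extend_apply' _ _ _ h, if_neg]
    rintro rfl
    exact h ⟨k, rfl⟩

/-- `Function.extend e R S` holds `R` on the renamed stacks and `S` on all others. As `e` is
injective, updates commute with this extension, so an execution is carried over step by step. -/
theorem Exec.map_extend {K K' : Type} {e : K → K'} (he : e.Injective) {p : Prog K}
    {R R' : Stacks K} {n : ℕ} (h : Exec p R n R') (S : Stacks K') :
    Exec (p.map e) (Function.extend e R S) n (Function.extend e R' S) := by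
  induction h with
  | nop R => exact .nop _
  | push k b R =>
    rw [← Stacks.extend_set he]
    simpa only [he.extend_apply, Prog.map] using Exec.push (e k) b (Function.extend e R S)
  | pop k R =>
    rw [← Stacks.extend_set he]
    simpa only [he.extend_apply, Prog.map] using Exec.pop (e k) (Function.extend e R S)
  | seq _ _ h1 h2 => exact .seq h1 h2
  | ite_true hk _ h => exact .ite_true (by rwa [he.extend_apply]) h
  | ite_false hk _ h => exact .ite_false (by rwa [he.extend_apply]) h
  | drain_nil hk => exact .drain_nil (by rwa [he.extend_apply])
  | drain_true hk _ _ h1 h2 =>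
    exact .drain_true (by rwa [he.extend_apply]) (by rwa [Stacks.extend_set he]) h2
  | drain_false hk _ _ h1 h2 =>
    exact .drain_false (by rwa [he.extend_apply]) (by rwa [Stacks.extend_set he]) h2

/-- A program with renamed stacks acts on the renamed stacks and leaves all others alone. -/
theorem Exec.map {K K' : Type} {e : K → K'} (he : e.Injective) {p : Prog K}
    {R R' : Stacks K} {n : ℕ} (h : Exec p R n R') {S S' : Stacks K'}
    (hR : ∀ k, S (e k) = R k) (hR' : ∀ k, S' (e k) = R' k)
    (hS : ∀ k', (∀ k, e k ≠ k') → S' k' = S k') : Exec (p.map e) S n S' := by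
  have key : ∀ (T : Stacks K) (U : Stacks K'), (∀ k, U (e k) = T k) →
      (∀ k', (∀ k, e k ≠ k') → U k' = S k') → Function.extend e T S = U := by
    intro T U h1 h2
    funext k'
    by_cases h : ∃ k₀, e k₀ = k'
    · obtain ⟨k₀, rfl⟩ := h
      rw [he.extend_apply, h1]
    · rw [Function.extend_apply' _ _ _ h, h2 _ (not_exists.1 h)]
  have := h.map_extend he S
  rwa [key R S hR fun _ _ => rfl, key R' S' hR' hS] at this

/-! ### Compiling programs to Turing machines -/

open Turing

/-- The labels that the Turing machine for a program uses. -/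
def Prog.Lab {K : Type} : Prog K → Type
  | .nop | .push _ _ | .pop _ => Unit
  | .seq p q => p.Lab ⊕ q.Lab
  | .ite _ p q | .drain _ p q => Option (p.Lab ⊕ q.Lab)

theorem Prog.finite_lab {K : Type} : ∀ p : Prog K, Finite p.Lab
  | .nop | .push _ _ | .pop _ => inferInstanceAs (Finite Unit)
  | .seq p q =>
    have := p.finite_lab
    have := q.finite_lab
    inferInstanceAs (Finite (p.Lab ⊕ q.Lab))
  | .ite _ p q | .drain _ p q =>
    have := p.finite_lab
    have := q.finite_lab
    inferInstanceAs (Finite (Option (p.Lab ⊕ q.Lab)))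

/-- The label at which the execution of a program starts. -/
def Prog.entry {K : Type} : (p : Prog K) → p.Lab
  | .nop | .push _ _ | .pop _ => ()
  | .seq p _ => Sum.inl p.entry
  | .ite _ _ _ | .drain _ _ _ => none

/-- The statements of the Turing machine for a program, whose labels are embedded by `emb` into the
labels of a bigger machine, and that jumps to the label `exit` after the execution. -/
def Prog.code {K Λ : Type} : (p : Prog K) → (p.Lab → Λ) → Λ → p.Lab →
    TM2.Stmt (fun _ : K => Bool) Λ (Option Bool)
  | .nop, _, exit, _ => .goto fun _ => exit
  | .push k b, _, exit, _ => .push k (fun _ => b) (.goto fun _ => exit)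
  | .pop k, _, exit, _ => .pop k (fun v _ => v) (.goto fun _ => exit)
  | .seq p q, emb, exit, l =>
    match l with
    | Sum.inl l => p.code (fun l => emb (Sum.inl l)) (emb (Sum.inr q.entry)) l
    | Sum.inr l => q.code (fun l => emb (Sum.inr l)) exit l
  | .ite k p q, emb, exit, l =>
    match l with
    | none => .peek k (fun _ o => o) (.branch (fun v => v == some true)
        -- The tested bit is erased from the internal state, because every fragment is entered with
        -- state `none`.
        (.load (fun _ => none) (.goto fun _ => emb (some (Sum.inl p.entry))))
        (.load (fun _ => none) (.goto fun _ => emb (some (Sum.inr q.entry)))))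
    | some (Sum.inl l) => p.code (fun l => emb (some (Sum.inl l))) exit l
    | some (Sum.inr l) => q.code (fun l => emb (some (Sum.inr l))) exit l
  | .drain k p q, emb, exit, l =>
    match l with
    | none => .pop k (fun _ o => o) (.branch (fun v => v == none) (.goto fun _ => exit)
        (.branch (fun v => v == some true)
          (.load (fun _ => none) (.goto fun _ => emb (some (Sum.inl p.entry))))
          (.load (fun _ => none) (.goto fun _ => emb (some (Sum.inr q.entry))))))
    | some (Sum.inl l) => p.code (fun l => emb (some (Sum.inl l))) (emb none) l
    | some (Sum.inr l) => q.code (fun l => emb (some (Sum.inr l))) (emb none) l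

/-- Iterated steps of a Turing machine. -/
inductive Steps {C : Type} (f : C → Option C) : ℕ → C → C → Prop
  | refl (a) : Steps f 0 a a
  | cons {a b c n} : f a = some b → Steps f n b c → Steps f (1 + n) a c

theorem Steps.trans {C : Type} {f : C → Option C} {m n : ℕ} {a b c : C} (h : Steps f m a b)
    (h' : Steps f n b c) : Steps f (m + n) a c := by
  induction h with
  | refl a => simpa using h'
  | cons h1 _ ih =>
    rw [add_assoc]
    exact .cons h1 (ih h')

theorem Steps.single {C : Type} {f : C → Option C} {a b : C} (h : f a = some b) :
    Steps f 1 a b := .cons h (.refl b)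

theorem Steps.iterate {C : Type} {f : C → Option C} {m : ℕ} {a b : C} (h : Steps f m a b) :
    (flip bind f)^[m] (some a) = some b := by
  induction h with
  | refl a => rfl
  | @cons a b c n h _ ih =>
    rw [add_comm, Function.iterate_succ_apply]
    have : flip bind f (some a) = some b := h
    rw [this, ih]

open Classical in
-- Induction on the execution: each unit of cost in `Exec` is one machine step. The branches of a
-- `drain` jump back to its own label, so the induction hypothesis for the remaining loop applies
-- with the same `emb` and `exit`.
theorem Prog.steps_code {K Λ : Type} (M : Λ → TM2.Stmt (fun _ : K => Bool) Λ (Option Bool))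
    {p : Prog K} {R R' : Stacks K} {n : ℕ} (h : Exec p R n R') :
    ∀ (emb : p.Lab → Λ) (exit : Λ), (∀ l, M (emb l) = p.code emb exit l) →
      Steps (TM2.step M) n ⟨some (emb p.entry), none, R⟩ ⟨some exit, none, R'⟩ := by
  induction h with
  | nop R | push k b R | pop k R =>
    intro emb exit hM
    refine Steps.single ?_
    rw [TM2.step, hM]
    rfl
  | seq _ _ h1 h2 =>
    intro emb exit hM
    exact (h1 _ _ fun l => hM (Sum.inl l)).trans (h2 _ _ fun l => hM (Sum.inr l))
  | ite_true hk _ h =>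
    intro emb exit hM
    refine .cons ?_ (h (fun l => emb (some (Sum.inl l))) exit fun l => hM (some (Sum.inl l)))
    rw [TM2.step, hM]
    simp [Prog.entry, Prog.code, hk]
  | ite_false hk _ h =>
    intro emb exit hM
    refine .cons ?_ (h (fun l => emb (some (Sum.inr l))) exit fun l => hM (some (Sum.inr l)))
    rw [TM2.step, hM]
    have : ((_ : List Bool).head? == some true) = false := beq_eq_false_iff_ne.2 hk
    simp [Prog.entry, Prog.code, this]
  | @drain_nil k p q R hk =>
    intro emb exit hM
    refine Steps.single ?_
    rw [TM2.step, hM]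
    have : Function.update R k [] = R := by rw [← hk]; exact Function.update_eq_self _ _
    simp [Prog.entry, Prog.code, hk, this]
  | drain_true hk _ _ h1 h2 =>
    intro emb exit hM
    rw [add_assoc]
    refine .cons ?_ ((h1 (fun l => emb (some (Sum.inl l))) _ fun l => hM (some (Sum.inl l))).trans
      (h2 emb exit hM))
    rw [TM2.step, hM]
    simp [Prog.entry, Prog.code, hk, Stacks.set]
  | drain_false hk _ _ h1 h2 =>
    intro emb exit hM
    rw [add_assoc]
    refine .cons ?_ ((h1 (fun l => emb (some (Sum.inr l))) _ fun l => hM (some (Sum.inr l))).trans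
      (h2 emb exit hM))
    rw [TM2.step, hM]
    simp [Prog.entry, Prog.code, hk, Stacks.set]

open Classical in
/-- A function on bit strings with values in `Bool` is computable in polynomial time if it is
computed by a structured program in polynomial time. -/
theorem tm2ComputableInPolyTime_of_exec {K : Type} [Finite K] (k₀ k₁ : K) (p : Prog K)
    (q : Polynomial ℕ) (f : List Bool → Bool)
    (h : ∀ w, ∃ n ≤ q.eval w.length,
      Exec p (Stacks.set (fun _ => []) k₀ w) n (Stacks.set (fun _ => []) k₁ [f w])) :
    Nonempty (TM2ComputableInPolyTime (id : List Bool → List Bool) Computability.encodeBool f) := by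
  have := Fintype.ofFinite K
  have := p.finite_lab
  have := Fintype.ofFinite p.Lab
  refine ⟨{
    tm := {
      K := K
      kDecidableEq := Classical.decEq K
      k₀ := k₀
      k₁ := k₁
      Γ := fun _ => Bool
      Λ := Option p.Lab
      main := some p.entry
      σ := Option Bool
      initialState := none
      m := fun l => match l with
        | none => .halt
        | some l => p.code some none l }
    inputAlphabet := Equiv.refl Bool
    outputAlphabet := Equiv.refl Bool
    -- The additional step executes `halt` at the label `none`.
    time := q + 1
    outputsFun := fun w => Classical.choice ?_ }⟩
  obtain ⟨n, hn, hp⟩ := h w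
  refine ⟨⟨⟨n + 1, ?_⟩, by simpa using hn⟩⟩
  refine Steps.iterate ((Steps.trans (b := ?_) (?_ : Steps _ n _ _) (.single ?_)))
  · exact ⟨some none, none, Stacks.set (fun _ => []) k₁ [f w]⟩
  · have key : ∀ S : Stacks K, S = Stacks.set (fun _ => []) k₀ w →
        Steps (TM2.step (fun l : Option p.Lab => match l with
          | none => .halt
          | some l => p.code some none l)) n ⟨some (some p.entry), none, S⟩
          ⟨some none, none, Stacks.set (fun _ => []) k₁ [f w]⟩ := by
      rintro _ rfl
      exact Prog.steps_code _ hp some none fun l => rfl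
    refine key _ (funext fun k => ?_)
    rw [Stacks.set_apply]
    split_ifs
    · exact List.map_id w
    · rfl
  · simp only [FinTM2.step, TM2.step, TM2.stepAux, haltList]
    congr 2
    funext k
    rw [Stacks.set_apply]
    by_cases hk : k = k₁
    · subst hk
      simp [Computability.encodeBool]
    · simp [hk]

end PossibleManipulators

namespace PossibleManipulators

/-! ### Functions computable in polynomial time -/

/-- Coefficients are natural numbers, so polynomials are monotone and bounds on sizes can be
substituted into bounds on time. -/
theorem eval_le_eval (q : Polynomial ℕ) {a b : ℕ} (h : a ≤ b) : q.eval a ≤ q.eval b := by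
  rw [Polynomial.eval_eq_sum, Polynomial.eval_eq_sum]
  exact Finset.sum_le_sum fun i _ => Nat.mul_le_mul_left _ (Nat.pow_le_pow_left h i)

/-- Types whose elements are represented by the contents of finitely many stacks. -/
class Dat (α : Type) where
  Reg : Type
  [fin : Fintype Reg]
  enc : α → Stacks Reg

attribute [reducible, instance] Dat.fin

open Dat

instance : Dat Bool := ⟨Unit, fun b _ => [b]⟩

instance : Dat (List Bool) := ⟨Unit, fun l _ => l⟩

/-- In unary the size of a number is its value. A loop over the bits of `n` then makes `n` rounds,
and a polynomial bound on the size is a polynomial bound on the value. -/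
instance : Dat ℕ := ⟨Unit, fun n _ => List.replicate n true⟩

instance {α β : Type} [Dat α] [Dat β] : Dat (α × β) :=
  ⟨Reg α ⊕ Reg β, fun x => Sum.elim (enc x.1) (enc x.2)⟩

/-- The total length of the representation. -/
def size {α : Type} [Dat α] (a : α) : ℕ := ∑ r, (enc a r).length

theorem length_enc_le_size {α : Type} [Dat α] (a : α) (r : Reg α) : (enc a r).length ≤ size a :=
  Finset.single_le_sum (f := fun r => (enc a r).length) (fun _ _ => Nat.zero_le _)
    (Finset.mem_univ r)

@[simp] theorem size_prod {α β : Type} [Dat α] [Dat β] (a : α) (b : β) :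
    size (a, b) = size a + size b := by
  simp only [size]
  exact Fintype.sum_sum_type _

@[simp] theorem size_bool (b : Bool) : size b = 1 := rfl

@[simp] theorem size_list (l : List Bool) : size l = l.length := by
  change ∑ _r : Unit, l.length = l.length
  simp

@[simp] theorem size_nat (n : ℕ) : size n = n := by
  change ∑ _r : Unit, (List.replicate n true).length = n
  simp

/-- Input stacks, output stacks and empty auxiliary stacks. -/
abbrev regs {ι ο : Type} (T : Type) (a : Stacks ι) (b : Stacks ο) : Stacks (ι ⊕ ο ⊕ T) :=
  Sum.elim a (Sum.elim b fun _ => [])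

/-- `PT f`: some structured program computes `f` in polynomial time, preserves its input, and leaves
its auxiliary stacks empty. -/
def PT {α β : Type} [Dat α] [Dat β] (f : α → β) : Prop :=
  ∃ (T : Type) (_ : Finite T) (p : Prog (Reg α ⊕ Reg β ⊕ T)) (q : Polynomial ℕ),
    ∀ a, ∃ n ≤ q.eval (size a), Exec p (regs T (enc a) fun _ => []) n (regs T (enc a) (enc (f a)))

/-- Only the stack contents matter. This allows a unary number to be treated as a list of `true` and
conversely. -/
theorem PT.congr_enc {α β γ : Type} [Dat α] [Dat β] [Dat γ] {f : α → β} {g : α → γ} (hf : PT f)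
    (e : Reg γ ≃ Reg β) (h : ∀ a r, enc (f a) (e r) = enc (g a) r) : PT g := by
  obtain ⟨T, hT, p, q, hp⟩ := hf
  refine ⟨T, hT, p.map (Sum.map id (Sum.map e.symm id)), q, fun a => ?_⟩
  obtain ⟨n, hn, hp⟩ := hp a
  refine ⟨n, hn, hp.map ?_ ?_ ?_ ?_⟩
  · exact Function.injective_id.sumMap (e.symm.injective.sumMap Function.injective_id)
  · rintro (k | k | k) <;> rfl
  · rintro (k | k | k)
    · rfl
    · simp [← h]
    · rfl
  · rintro (k | k | k) hk
    · rfl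
    · exact absurd (by simp) (hk (Sum.inr (Sum.inl (e k))))
    · rfl

/-- The output stacks start empty, so each of them ends no longer than the running time. -/
theorem PT.exists_size_le {α β : Type} [Dat α] [Dat β] {f : α → β} (hf : PT f) :
    ∃ q : Polynomial ℕ, ∀ a, size (f a) ≤ q.eval (size a) := by
  obtain ⟨T, _, p, q, hp⟩ := hf
  refine ⟨Polynomial.C (Fintype.card (Reg β)) * q, fun a => ?_⟩
  obtain ⟨n, hn, hp⟩ := hp a
  rw [Polynomial.eval_mul, Polynomial.eval_C, ← smul_eq_mul]
  refine Finset.sum_le_card_nsmul _ _ _ fun r _ => ?_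
  have := hp.length_le (Sum.inr (Sum.inl r))
  simp only [Sum.elim_inr, Sum.elim_inl, List.length_nil] at this
  omega

/-! #### Copying and clearing stacks -/

theorem Exec.cast {K : Type} {p : Prog K} {R S S' : Stacks K} {n n' : ℕ} (h : Exec p R n S)
    (hn : n = n') (hS : S = S') : Exec p R n' S' := hn ▸ hS ▸ h

theorem exec_clear {K : Type} (k : K) :
    ∀ (l : List Bool) (R : Stacks K), R k = l →
      Exec (.drain k .nop .nop) R (1 + 2 * l.length) (R.set k [])
  | [], R, h => by
    refine (Exec.drain_nil h).cast rfl ?_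
    funext k'
    by_cases hk : k' = k
    · subst hk; simpa using h
    · rw [Stacks.set_of_ne _ hk]
  | b :: l, R, h => by
    have ih := exec_clear k l (R.set k l) (by simp)
    have e : (R.set k l).set k [] = R.set k [] := by
      funext k'
      by_cases hk : k' = k
      · subst hk; simp
      · simp only [Stacks.set_of_ne _ hk]
    cases b with
    | true => exact (Exec.drain_true h (.nop _) ih).cast (by simp; ring) e
    | false => exact (Exec.drain_false h (.nop _) ih).cast (by simp; ring) e

/-- Empty the stacks in a list. -/
def clearList {K : Type} : List K → Prog K
  | [] => .nop
  | k :: L => .seq (.drain k .nop .nop) (clearList L)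

open Classical in
theorem exec_clearList {K : Type} (N : ℕ) : ∀ (L : List K) (R : Stacks K),
    (∀ k, (R k).length ≤ N) → ∃ n ≤ 1 + L.length * (1 + 2 * N),
      Exec (clearList L) R n fun k => if k ∈ L then [] else R k
  | [], R, _ => ⟨1, by simp, by simpa [clearList] using Exec.nop R⟩
  | k :: L, R, h => by
    obtain ⟨n, hn, h1⟩ := exec_clearList N L (R.set k []) fun k' => by
      rw [Stacks.set_apply]
      split_ifs
      · simp
      · exact h k'
    refine ⟨_, ?_, ((exec_clear k _ R rfl).seq h1).cast rfl ?_⟩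
    · have := h k
      rw [List.length_cons, Nat.add_mul]
      omega
    · funext k'
      by_cases h1 : k' ∈ L <;> by_cases h2 : k' = k <;> simp [h1, h2, Stacks.set_apply]

/-- Empty all stacks. -/
noncomputable def clearAll (ρ : Type) [Fintype ρ] : Prog ρ := clearList Finset.univ.toList

theorem exec_clearAll {ρ : Type} [Fintype ρ] (N : ℕ) (R : Stacks ρ) (h : ∀ k, (R k).length ≤ N) :
    ∃ n ≤ 1 + Fintype.card ρ * (1 + 2 * N), Exec (clearAll ρ) R n fun _ => [] := by
  obtain ⟨n, hn, h1⟩ := exec_clearList N Finset.univ.toList R h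
  rw [Finset.length_toList, Finset.card_univ] at hn
  exact ⟨n, hn, h1.cast rfl (by simp)⟩

/-- Moving a stack onto another reverses it; a second move, by `exec_distribute`, restores the
order. -/
theorem exec_reverse {K : Type} {k t : K} (hkt : k ≠ t) :
    ∀ (l : List Bool) (R : Stacks K), R k = l →
      Exec (.drain k (.push t true) (.push t false)) R (1 + 2 * l.length)
        ((R.set k []).set t (l.reverse ++ R t))
  | [], R, h => by
    refine (Exec.drain_nil h).cast rfl ?_
    funext k'
    by_cases hk : k' = k
    · subst hk; simpa [Stacks.set_of_ne _ hkt] using h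
    · by_cases ht : k' = t
      · subst ht; simp
      · simp only [Stacks.set_of_ne _ hk, Stacks.set_of_ne _ ht]
  | b :: l, R, h => by
    have ih := exec_reverse hkt l ((R.set k l).set t (b :: R t))
      (by simp [Stacks.set_of_ne _ hkt])
    have e : ((((R.set k l).set t (b :: R t)).set k []).set t
        (l.reverse ++ ((R.set k l).set t (b :: R t)) t)) =
        (R.set k []).set t ((b :: l).reverse ++ R t) := by
      funext k'
      by_cases ht : k' = t
      · subst ht; simp
      · by_cases hk : k' = k
        · subst hk; simp [Stacks.set_of_ne _ hkt]
        · simp only [Stacks.set_of_ne _ hk, Stacks.set_of_ne _ ht]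
    have e1 : (R.set k l) t = R t := Stacks.set_of_ne _ hkt.symm _
    cases b with
    | true =>
      exact (Exec.drain_true h ((Exec.push t true _).cast rfl (by rw [e1])) ih).cast
        (by simp; ring) e
    | false =>
      exact (Exec.drain_false h ((Exec.push t false _).cast rfl (by rw [e1])) ih).cast
        (by simp; ring) e

/-- Emptying the temporary stack onto two stacks at once restores the original and creates the copy.
-/
theorem exec_distribute {K : Type} {t k d : K} (htk : t ≠ k) (htd : t ≠ d) (hkd : k ≠ d) :
    ∀ (l : List Bool) (R : Stacks K), R t = l →
      Exec (.drain t (.seq (.push k true) (.push d true)) (.seq (.push k false) (.push d false))) R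
        (1 + 3 * l.length)
        (((R.set t []).set k (l.reverse ++ R k)).set d (l.reverse ++ R d))
  | [], R, h => by
    refine (Exec.drain_nil h).cast rfl ?_
    funext k'
    by_cases h1 : k' = d
    · subst h1; simp
    · by_cases h2 : k' = k
      · subst h2; simp [Stacks.set_of_ne _ hkd]
      · by_cases h3 : k' = t
        · subst h3; simpa [Stacks.set_of_ne _ htk, Stacks.set_of_ne _ htd] using h
        · simp only [Stacks.set_of_ne _ h1, Stacks.set_of_ne _ h2, Stacks.set_of_ne _ h3]
  | b :: l, R, h => by
    have ih := exec_distribute htk htd hkd l (((R.set t l).set k (b :: R k)).set d (b :: R d))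
      (by simp [Stacks.set_of_ne _ htk, Stacks.set_of_ne _ htd])
    have e : ((((((R.set t l).set k (b :: R k)).set d (b :: R d)).set t []).set k
        (l.reverse ++ (((R.set t l).set k (b :: R k)).set d (b :: R d)) k)).set d
        (l.reverse ++ (((R.set t l).set k (b :: R k)).set d (b :: R d)) d)) =
        ((R.set t []).set k ((b :: l).reverse ++ R k)).set d ((b :: l).reverse ++ R d) := by
      funext k'
      by_cases h1 : k' = d
      · subst h1; simp
      · by_cases h2 : k' = k
        · subst h2; simp [Stacks.set_of_ne _ hkd]
        · by_cases h3 : k' = t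
          · subst h3; simp [Stacks.set_of_ne _ htk, Stacks.set_of_ne _ htd]
          · simp only [Stacks.set_of_ne _ h1, Stacks.set_of_ne _ h2, Stacks.set_of_ne _ h3]
    have e1 : (R.set t l) k = R k := Stacks.set_of_ne _ htk.symm _
    have e2 : ∀ l', ((R.set t l).set k l') d = R d := fun l' => by
      rw [Stacks.set_of_ne _ hkd.symm, Stacks.set_of_ne _ htd.symm]
    have step : ∀ b, Exec (.seq (.push k b) (.push d b)) (R.set t l) (1 + 1)
        (((R.set t l).set k (b :: R k)).set d (b :: R d)) := fun b =>
      ((Exec.push k b _).seq (Exec.push d b _)).cast rfl (by rw [e1, e2])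
    cases b with
    | true => exact (Exec.drain_true h (step true) ih).cast (by simp; ring) e
    | false => exact (Exec.drain_false h (step false) ih).cast (by simp; ring) e

/-- Copy the stacks in a list. -/
def copyList {ρ : Type} : List ρ → Prog (ρ ⊕ ρ ⊕ Unit)
  | [] => .nop
  | r :: L => .seq (.seq
      (.drain (.inl r) (.push (.inr (.inr ())) true) (.push (.inr (.inr ())) false))
      (.drain (.inr (.inr ()))
        (.seq (.push (.inl r) true) (.push (.inr (.inl r)) true))
        (.seq (.push (.inl r) false) (.push (.inr (.inl r)) false)))) (copyList L)

open Classical in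
-- A stack of length `ℓ` costs `1 + 2ℓ` for the move to the temporary stack and `1 + 3ℓ` for the
-- move back to both targets, hence the summand `2 + 5 * N`.
theorem exec_copyList {ρ : Type} (N : ℕ) (a : Stacks ρ) (ha : ∀ r, (a r).length ≤ N) :
    ∀ (L : List ρ) (b : Stacks ρ), L.Nodup → (∀ r ∈ L, b r = []) →
    ∃ n ≤ 1 + L.length * (2 + 5 * N), Exec (copyList L) (regs Unit a b) n
      (regs Unit a fun r => if r ∈ L then a r else b r)
  | [], b, _, _ => ⟨1, by simp, by simpa [copyList] using Exec.nop _⟩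
  | r :: L, b, hL, hb => by
    rw [List.nodup_cons] at hL
    obtain ⟨n, hn, h1⟩ := exec_copyList N a ha L (b.set r (a r)) hL.2 fun r' hr' => by
      rw [Stacks.set_of_ne _ (by rintro rfl; exact hL.1 hr')]
      exact hb r' (List.mem_cons_of_mem _ hr')
    refine ⟨_, ?_, ((((exec_reverse (by simp) _ _ rfl).seq
      ((exec_distribute (by simp) (by simp) (by simp) (a r).reverse _ (by simp)).cast rfl
        ?_)).seq h1).cast rfl ?_)⟩
    · simp only [Sum.elim_inl, List.length_reverse, List.length_cons]
      have := ha r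
      rw [Nat.add_mul]
      omega
    · funext k
      rcases k with k | k | k
      · by_cases hk : k = r
        · subst hk; simp [Stacks.set_apply]
        · simp [Stacks.set_apply, hk]
      · by_cases hk : k = r
        · subst hk; simp [Stacks.set_apply, hb k]
        · simp [Stacks.set_apply, hk]
      · simp [Stacks.set_apply]
    · congr 2
      funext r'
      by_cases h1 : r' = r
      · subst h1; simp
      · simp [Stacks.set_apply, h1]

/-! ### Closure under composition, pairing, projections and case distinction. -/

namespace PT

variable {α β γ σ : Type} [Dat α] [Dat β] [Dat γ] [Dat σ]

protected theorem id : PT (id : α → α) := by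
  refine ⟨Unit, inferInstance, copyList Finset.univ.toList,
    1 + Polynomial.C (Fintype.card (Reg α)) * (2 + 5 * Polynomial.X), fun a => ?_⟩
  obtain ⟨n, hn, h⟩ := exec_copyList (size a) (enc a) (length_enc_le_size a) Finset.univ.toList
    (fun _ => []) (Finset.nodup_toList _) fun _ _ => rfl
  refine ⟨n, by simpa using hn, h.cast rfl ?_⟩
  congr 2
  simp

theorem congr {f g : α → β} (hf : PT f) (h : ∀ a, f a = g a) : PT g := by
  rwa [← funext h]

/-- The intermediate value lives on auxiliary stacks, which are cleared at the end. Its size is at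
most `r`, so both the second program and the clearing stay polynomial in the size of `a`. -/
theorem comp {g : β → γ} {f : α → β} (hg : PT g) (hf : PT f) : PT fun a => g (f a) := by
  obtain ⟨r, hr⟩ := hf.exists_size_le
  obtain ⟨Tf, _, pf, qf, hf⟩ := hf
  obtain ⟨Tg, _, pg, qg, hg⟩ := hg
  refine ⟨Reg β ⊕ Tf ⊕ Tg, inferInstance,
    .seq (pf.map (Sum.elim Sum.inl (Sum.elim (fun k => .inr (.inr (.inl k)))
      fun k => .inr (.inr (.inr (.inl k))))))
    (.seq (pg.map (Sum.elim (fun k => .inr (.inr (.inl k))) (Sum.elim (fun k => .inr (.inl k))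
      fun k => .inr (.inr (.inr (.inr k))))))
    ((clearAll (Reg β)).map fun k => .inr (.inr (.inl k)))),
    qf + (qg.comp r + (1 + Polynomial.C (Fintype.card (Reg β)) * (1 + 2 * r))), fun a => ?_⟩
  obtain ⟨n1, hn1, h1⟩ := hf a
  obtain ⟨n2, hn2, h2⟩ := hg (f a)
  obtain ⟨n3, hn3, h3⟩ := exec_clearAll (r.eval (size a)) (enc (f a))
    fun k => (length_enc_le_size _ k).trans (hr a)
  refine ⟨n1 + (n2 + n3), ?_, .seq (R' := Sum.elim (enc a) (Sum.elim (fun _ => [])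
    (Sum.elim (enc (f a)) fun _ => []))) (h1.map ?_ ?_ ?_ ?_)
    (.seq (R' := Sum.elim (enc a) (Sum.elim (enc (g (f a)))
    (Sum.elim (enc (f a)) fun _ => []))) (h2.map ?_ ?_ ?_ ?_) (h3.map ?_ ?_ ?_ ?_))⟩
  · have := hn2.trans (eval_le_eval qg (hr a))
    simp only [Polynomial.eval_add, Polynomial.eval_mul, Polynomial.eval_C, Polynomial.eval_comp,
      Polynomial.eval_one, Polynomial.eval_ofNat]
    omega
  · rintro (k | k | k) (k' | k' | k') h <;> cases h <;> rfl
  · rintro (k | k | k) <;> rfl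
  · rintro (k | k | k) <;> rfl
  · rintro (k | k | k | k | k) h <;> first | rfl | exact absurd h (by simp)
  · rintro (k | k | k) (k' | k' | k') h <;> cases h <;> rfl
  · rintro (k | k | k) <;> rfl
  · rintro (k | k | k) <;> rfl
  · rintro (k | k | k | k | k) h <;> first | rfl | exact absurd h (by simp)
  · intro k k' h; simpa using h
  · exact fun _ => rfl
  · exact fun _ => rfl
  · rintro (k | k | k | k | k) h <;> first | rfl | exact absurd h (by simp)

/-- Since programs preserve their input, the two can run one after the other on the same input
stacks. -/
theorem pair {f : α → β} {g : α → γ} (hf : PT f) (hg : PT g) : PT fun a => (f a, g a) := by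
  obtain ⟨Tf, _, pf, qf, hf⟩ := hf
  obtain ⟨Tg, _, pg, qg, hg⟩ := hg
  refine ⟨Tf ⊕ Tg, inferInstance,
    .seq (pf.map (Sum.elim Sum.inl (Sum.elim (fun k => .inr (.inl (.inl k)))
      fun k => .inr (.inr (.inl k)))))
    (pg.map (Sum.elim Sum.inl (Sum.elim (fun k => .inr (.inl (.inr k)))
      fun k => .inr (.inr (.inr k))))), qf + qg, fun a => ?_⟩
  obtain ⟨n1, hn1, h1⟩ := hf a
  obtain ⟨n2, hn2, h2⟩ := hg a
  refine ⟨n1 + n2, ?_, .seq (R' := Sum.elim (enc a) (Sum.elim (Sum.elim (enc (f a)) fun _ => [])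
    (Sum.elim (fun _ => []) fun _ => []))) (h1.map ?_ ?_ ?_ ?_) (h2.map ?_ ?_ ?_ ?_)⟩
  · rw [Polynomial.eval_add]
    omega
  · rintro (k | k | k) (k' | k' | k') h <;> cases h <;> rfl
  · rintro (k | k | k) <;> rfl
  · rintro (k | k | k) <;> rfl
  · rintro (k | (k | k) | k | k) h <;> first | rfl | exact absurd h (by simp)
  · rintro (k | k | k) (k' | k' | k') h <;> cases h <;> rfl
  · rintro (k | k | k) <;> rfl
  · rintro (k | k | k) <;> rfl
  · rintro (k | (k | k) | k | k) h <;> first | rfl | exact absurd h (by simp)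

protected theorem fst : PT (Prod.fst : α × β → α) := by
  obtain ⟨T, _, p, q, h⟩ := PT.id (α := α)
  refine ⟨T, inferInstance, p.map (Sum.elim (fun k => .inl (.inl k)) .inr), q, fun a => ?_⟩
  obtain ⟨n, hn, h⟩ := h a.1
  refine ⟨n, hn.trans (eval_le_eval q (by rw [size_prod]; omega)), h.map ?_ ?_ ?_ ?_⟩
  · rintro (k | k | k) (k' | k' | k') h <;> cases h <;> rfl
  · rintro (k | k | k) <;> rfl
  · rintro (k | k | k) <;> rfl
  · rintro ((k | k) | k | k) h <;> first | rfl | exact absurd h (by simp)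

protected theorem snd : PT (Prod.snd : α × β → β) := by
  obtain ⟨T, _, p, q, h⟩ := PT.id (α := β)
  refine ⟨T, inferInstance, p.map (Sum.elim (fun k => .inl (.inr k)) .inr), q, fun a => ?_⟩
  obtain ⟨n, hn, h⟩ := h a.2
  refine ⟨n, hn.trans (eval_le_eval q (by rw [size_prod]; omega)), h.map ?_ ?_ ?_ ?_⟩
  · rintro (k | k | k) (k' | k' | k') h <;> cases h <;> rfl
  · rintro (k | k | k) <;> rfl
  · rintro (k | k | k) <;> rfl
  · rintro ((k | k) | k | k) h <;> first | rfl | exact absurd h (by simp)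

/-- The condition occupies a single auxiliary bit, which one `pop` removes after the branch. -/
theorem cond {c : α → Bool} {f g : α → β} (hc : PT c) (hf : PT f) (hg : PT g) :
    PT fun a => bif c a then f a else g a := by
  obtain ⟨Tc, _, pc, qc, hc⟩ := hc
  obtain ⟨Tf, _, pf, qf, hf⟩ := hf
  obtain ⟨Tg, _, pg, qg, hg⟩ := hg
  let kc : Reg α ⊕ Reg β ⊕ (Unit ⊕ Tc ⊕ Tf ⊕ Tg) := .inr (.inr (.inl ()))
  refine ⟨Unit ⊕ Tc ⊕ Tf ⊕ Tg, inferInstance,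
    .seq (pc.map (Sum.elim Sum.inl (Sum.elim (fun k => .inr (.inr (.inl k)))
      fun k => .inr (.inr (.inr (.inl k))))))
    (.seq (.ite kc
      (pf.map (Sum.elim Sum.inl (Sum.elim (fun k => .inr (.inl k))
        fun k => .inr (.inr (.inr (.inr (.inl k)))))))
      (pg.map (Sum.elim Sum.inl (Sum.elim (fun k => .inr (.inl k))
        fun k => .inr (.inr (.inr (.inr (.inr k)))))))) (.pop kc)),
    qc + (1 + (qf + qg)) + 1, fun a => ?_⟩
  obtain ⟨n1, hn1, h1⟩ := hc a
  obtain ⟨n2, hn2, h2⟩ := hf a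
  obtain ⟨n3, hn3, h3⟩ := hg a
  let S : Stacks (Reg α ⊕ Reg β ⊕ (Unit ⊕ Tc ⊕ Tf ⊕ Tg)) :=
    Sum.elim (enc a) (Sum.elim (fun _ => []) (Sum.elim (enc (c a)) fun _ => []))
  let S' : Stacks (Reg α ⊕ Reg β ⊕ (Unit ⊕ Tc ⊕ Tf ⊕ Tg)) :=
    Sum.elim (enc a) (Sum.elim (enc (bif c a then f a else g a))
      (Sum.elim (enc (c a)) fun _ => []))
  obtain ⟨n, hn, h⟩ : ∃ n ≤ 1 + ((qf + qg).eval (size a)), Exec (.ite kc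
      (pf.map (Sum.elim Sum.inl (Sum.elim (fun k => .inr (.inl k))
        fun k => .inr (.inr (.inr (.inr (.inl k)))))))
      (pg.map (Sum.elim Sum.inl (Sum.elim (fun k => .inr (.inl k))
        fun k => .inr (.inr (.inr (.inr (.inr k)))))))) S n S' := by
    rw [Polynomial.eval_add]
    cases hca : c a with
    | true =>
      refine ⟨1 + n2, by omega, .ite_true ?_ (h2.map ?_ ?_ ?_ ?_)⟩
      · simp [S, kc, hca, enc]
      · rintro (k | k | k) (k' | k' | k') h <;> cases h <;> rfl
      · rintro (k | k | k) <;> rfl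
      · rintro (k | k | k) <;> simp [S', hca]
      · rintro (k | k | k | k | k | k) h <;> first | rfl | exact absurd h (by simp)
    | false =>
      refine ⟨1 + n3, by omega, .ite_false ?_ (h3.map ?_ ?_ ?_ ?_)⟩
      · simp [S, kc, hca, enc]
      · rintro (k | k | k) (k' | k' | k') h <;> cases h <;> rfl
      · rintro (k | k | k) <;> rfl
      · rintro (k | k | k) <;> simp [S', hca]
      · rintro (k | k | k | k | k | k) h <;> first | rfl | exact absurd h (by simp)
  refine ⟨n1 + (n + 1), ?_, .seq (R' := S) (h1.map ?_ ?_ ?_ ?_)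
    (.seq h ((Exec.pop kc S').cast rfl ?_))⟩
  · simp only [Polynomial.eval_add, Polynomial.eval_one] at hn ⊢
    omega
  · rintro (k | k | k) (k' | k' | k') h <;> cases h <;> rfl
  · rintro (k | k | k) <;> rfl
  · rintro (k | k | k) <;> rfl
  · rintro (k | k | k | k | k | k) h <;> first | rfl | exact absurd h (by simp)
  · funext k
    rcases k with k | k | k | k <;> simp [kc, S', Stacks.set_apply, enc]

end PT

end PossibleManipulators

namespace PossibleManipulators

open Dat

/-! ### Bounded loops. -/

namespace PT

variable {α β γ σ : Type} [Dat α] [Dat β] [Dat γ] [Dat σ]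

/-- Iteration over the bits of a list, if the sizes of all intermediate results are polynomial. -/
theorem foldl {l : α → List Bool} {init : α → σ} {step : α → σ → Bool → σ} (hl : PT l)
    (hi : PT init) (hs : PT fun x : (α × σ) × Bool => step x.1.1 x.1.2 x.2) (B : Polynomial ℕ)
    (hB : ∀ a l', l' <+: l a → size (l'.foldl (step a) (init a)) ≤ B.eval (size a)) :
    PT fun a => (l a).foldl (step a) (init a) := by
  obtain ⟨r, hr⟩ := hl.exists_size_le
  obtain ⟨Tl, _, pl, ql, hl⟩ := hl
  obtain ⟨Ti, _, pi, qi, hi⟩ := hi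
  obtain ⟨Ts, _, ps, qs, hs⟩ := hs
  obtain ⟨Tc, _, pc, qc, hc⟩ := PT.id (α := σ)
  let T : Type := Unit ⊕ Reg σ ⊕ Unit ⊕ Tl ⊕ Ti ⊕ Ts ⊕ Tc
  let K : Type := Reg α ⊕ Reg σ ⊕ T
  let st (a : α) (o : Stacks (Reg σ)) (l : List Bool) (o' : Stacks (Reg σ)) (b : List Bool) :
      Stacks K :=
    Sum.elim (enc a) (Sum.elim o (Sum.elim (fun _ => l) (Sum.elim o' (Sum.elim (fun _ => b)
      (fun _ => [])))))
  let kl : K := .inr (.inr (.inl ()))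
  let ko : Reg σ → K := fun k => .inr (.inl k)
  let ko' : Reg σ → K := fun k => .inr (.inr (.inr (.inl k)))
  let kb : K := .inr (.inr (.inr (.inr (.inl ()))))
  let pl' : Prog K := pl.map (Sum.elim .inl (Sum.elim (fun _ => kl)
    fun k => .inr (.inr (.inr (.inr (.inr (.inl k)))))))
  let pi' : Prog K := pi.map (Sum.elim .inl (Sum.elim ko
    fun k => .inr (.inr (.inr (.inr (.inr (.inr (.inl k))))))))
  let ps' : Prog K := ps.map (Sum.elim (Sum.elim (Sum.elim .inl ko) fun _ => kb) (Sum.elim ko'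
    fun k => .inr (.inr (.inr (.inr (.inr (.inr (.inr (.inl k)))))))))
  let pc' : Prog K := pc.map (Sum.elim ko' (Sum.elim ko
    fun k => .inr (.inr (.inr (.inr (.inr (.inr (.inr (.inr k)))))))))
  -- The program for `step` needs empty output stacks, so the new state is written to `ko'`. The old
  -- state in `ko` is then cleared, the new one is copied there, and `ko'` is cleared for the next
  -- round.
  let body (b : Bool) : Prog K := .seq (.push kb b) (.seq ps' (.seq (.pop kb)
    (.seq ((clearAll (Reg σ)).map ko) (.seq pc' ((clearAll (Reg σ)).map ko')))))
  let clr : Polynomial ℕ := 1 + Polynomial.C (Fintype.card (Reg σ)) * (1 + 2 * B)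
  let cost : Polynomial ℕ := 2 + qs.comp (Polynomial.X + B + 1) + clr + qc.comp B + clr
  have hbody : ∀ a s l b, size s ≤ B.eval (size a) → size (step a s b) ≤ B.eval (size a) →
      ∃ n ≤ cost.eval (size a), Exec (body b) (st a (enc s) l (fun _ => []) []) n
        (st a (enc (step a s b)) l (fun _ => []) []) := by
    intro a s l b hs1 hs2
    obtain ⟨n1, hn1, h1⟩ := hs ((a, s), b)
    obtain ⟨n2, hn2, h2⟩ := exec_clearAll (B.eval (size a)) (enc s)
      fun k => (length_enc_le_size _ k).trans hs1
    obtain ⟨n3, hn3, h3⟩ := hc (step a s b)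
    obtain ⟨n4, hn4, h4⟩ := exec_clearAll (B.eval (size a)) (enc (step a s b))
      fun k => (length_enc_le_size _ k).trans hs2
    refine ⟨1 + (n1 + (1 + (n2 + (n3 + n4)))), ?_,
      .seq (R' := st a (enc s) l (fun _ => []) [b]) ((Exec.push kb b _).cast rfl ?_)
      (.seq (R' := st a (enc s) l (enc (step a s b)) [b]) (h1.map ?_ ?_ ?_ ?_)
      (.seq (R' := st a (enc s) l (enc (step a s b)) []) ((Exec.pop kb _).cast rfl ?_)
      (.seq (R' := st a (fun _ => []) l (enc (step a s b)) []) (h2.map ?_ ?_ ?_ ?_)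
      (.seq (R' := st a (enc (step a s b)) l (enc (step a s b)) []) (h3.map ?_ ?_ ?_ ?_)
      (h4.map ?_ ?_ ?_ ?_)))))⟩
    · simp only [size_prod, size_bool] at hn1
      have e1 := hn1.trans (eval_le_eval qs (Nat.add_le_add_right (Nat.add_le_add_left hs1 _) 1))
      have e3 := hn3.trans (eval_le_eval qc hs2)
      simp only [cost, clr, Polynomial.eval_add, Polynomial.eval_mul, Polynomial.eval_C,
        Polynomial.eval_comp, Polynomial.eval_one, Polynomial.eval_ofNat, Polynomial.eval_X]
      omega
    · refine Stacks.set_eq rfl ?_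
      rintro (k | k | k | k | k | k) <;> first | exact .inr rfl | exact .inl rfl
    · rintro (((k | k) | k) | k | k) (((k' | k') | k') | k' | k') h <;> cases h <;> rfl
    · rintro (((k | k) | k) | k | k) <;> rfl
    · rintro (((k | k) | k) | k | k) <;> rfl
    · rintro (k | k | k | k | k | k | k | k | k) h <;> first
        | rfl
        | exact absurd rfl (h (.inr (.inl k)))
    · refine Stacks.set_eq rfl ?_
      rintro (k | k | k | k | k | k) <;> first | exact .inr rfl | exact .inl rfl
    · intro k k' h; cases h; rfl
    · exact fun _ => rfl
    · exact fun _ => rfl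
    · rintro (k | k | k | k | k | k) h <;> first | rfl | exact absurd rfl (h k)
    · rintro (k | k | k) (k' | k' | k') h <;> cases h <;> rfl
    · rintro (k | k | k) <;> rfl
    · rintro (k | k | k) <;> rfl
    · rintro (k | k | k | k | k | k) h <;> first | rfl | exact absurd rfl (h (.inr (.inl k)))
    · intro k k' h; cases h; rfl
    · exact fun _ => rfl
    · exact fun _ => rfl
    · rintro (k | k | k | k | k | k) h <;> first | rfl | exact absurd rfl (h k)
  -- Loop invariant: with `l1` already read, the state is the fold over `l1`. Being a prefix of `l
  -- a`, `l1` falls under the size bound `hB`.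
  have hloop : ∀ a l2 l1, l1 ++ l2 = l a → ∃ n ≤ 1 + l2.length * (1 + cost.eval (size a)),
      Exec (.drain kl (body true) (body false))
        (st a (enc (l1.foldl (step a) (init a))) l2 (fun _ => []) []) n
        (st a (enc ((l a).foldl (step a) (init a))) [] (fun _ => []) []) := by
    intro a l2
    induction l2 with
    | nil =>
      intro l1 h
      rw [List.append_nil] at h
      exact ⟨1, by simp, h ▸ .drain_nil rfl⟩
    | cons b l2 ih =>
      intro l1 h
      have h' : (l1 ++ [b]) ++ l2 = l a := by simpa using h
      obtain ⟨n1, hn1, h1⟩ := ih _ h'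
      rw [List.foldl_append, List.foldl_cons, List.foldl_nil] at h1
      obtain ⟨n2, hn2, h2⟩ := hbody a (l1.foldl (step a) (init a)) l2 b (hB a _ ⟨_, h⟩) (by
        have := hB a _ ⟨_, h'⟩
        rwa [List.foldl_append, List.foldl_cons, List.foldl_nil] at this)
      refine ⟨1 + n2 + n1, ?_, ?_⟩
      · rw [List.length_cons, Nat.add_mul]
        omega
      · have e : (st a (enc (l1.foldl (step a) (init a))) (b :: l2) (fun _ => []) []).set kl l2 =
            st a (enc (l1.foldl (step a) (init a))) l2 (fun _ => []) [] := by
          refine Stacks.set_eq rfl ?_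
          rintro (k | k | k | k | k | k) <;> first | exact .inr rfl | exact .inl rfl
        cases b with
        | true => exact .drain_true rfl (e ▸ h2) h1
        | false => exact .drain_false rfl (e ▸ h2) h1
  refine ⟨T, inferInstance, .seq pl' (.seq pi' (.drain kl (body true) (body false))),
    ql + (qi + (1 + r * (1 + cost))), fun a => ?_⟩
  obtain ⟨n1, hn1, h1⟩ := hl a
  obtain ⟨n2, hn2, h2⟩ := hi a
  obtain ⟨n3, hn3, h3⟩ := hloop a (l a) [] rfl
  refine ⟨n1 + (n2 + n3), ?_,
    .seq (R' := st a (fun _ => []) (l a) (fun _ => []) []) (h1.map ?_ ?_ ?_ ?_)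
    (.seq (R' := st a (enc (init a)) (l a) (fun _ => []) []) (h2.map ?_ ?_ ?_ ?_)
    (h3.cast rfl ?_))⟩
  · have h := hr a
    rw [size_list] at h
    have := hn3.trans (Nat.add_le_add_left (Nat.mul_le_mul_right _ h) 1)
    simp only [Polynomial.eval_add, Polynomial.eval_mul, Polynomial.eval_one] at *
    omega
  · rintro (k | k | k) (k' | k' | k') h <;> cases h <;> rfl
  · rintro (k | k | k) <;> rfl
  · rintro (k | k | k) <;> rfl
  · rintro (k | k | k | k | k | k | k | k | k) h <;> first
      | rfl
      | exact absurd rfl (h (.inr (.inl ())))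
  · rintro (k | k | k) (k' | k' | k') h <;> cases h <;> rfl
  · rintro (k | k | k) <;> rfl
  · rintro (k | k | k) <;> rfl
  · rintro (k | k | k | k | k | k | k | k | k) h <;> first
      | rfl
      | exact absurd rfl (h (.inr (.inl k)))
  · funext k
    rcases k with k | k | k | k | k | k <;> rfl

/-! ### Constants and elementary operations on bit lists, Booleans and unary numbers. -/

theorem const_list : ∀ l : List Bool, PT fun _ : α => l
  | [] => ⟨Unit, inferInstance, .nop, 1, fun a => ⟨1, by simp, .nop _⟩⟩
  | b :: l => by
    obtain ⟨T, _, p, q, h⟩ := const_list l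
    refine ⟨T, inferInstance, .seq p (.push (.inr (.inl ())) b), q + 1, fun a => ?_⟩
    obtain ⟨n, hn, h⟩ := h a
    refine ⟨n + 1, by simpa using hn, .seq h ((Exec.push _ _ _).cast rfl ?_)⟩
    refine Stacks.set_eq rfl ?_
    rintro (k | k | k) <;> first | exact .inr rfl | exact .inl rfl

theorem const_bool (b : Bool) : PT fun _ : α => b :=
  (const_list [b]).congr_enc (Equiv.refl Unit) fun _ _ => rfl

theorem nat_of_list {f : α → ℕ} (h : PT fun a => List.replicate (f a) true) : PT f :=
  h.congr_enc (Equiv.refl Unit) fun _ _ => rfl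

theorem replicate {f : α → ℕ} (h : PT f) : PT fun a => List.replicate (f a) true :=
  h.congr_enc (Equiv.refl Unit) fun _ _ => rfl

theorem const_nat (n : ℕ) : PT fun _ : α => n := nat_of_list (const_list _)

theorem push (b : Bool) {f : α → List Bool} (hf : PT f) : PT fun a => b :: f a := by
  obtain ⟨T, _, p, q, h⟩ := hf
  refine ⟨T, inferInstance, .seq p (.push (.inr (.inl ())) b), q + 1, fun a => ?_⟩
  obtain ⟨n, hn, h⟩ := h a
  refine ⟨n + 1, by simpa using hn, .seq h ((Exec.push _ _ _).cast rfl ?_)⟩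
  refine Stacks.set_eq rfl ?_
  rintro (k | k | k) <;> first | exact .inr rfl | exact .inl rfl

theorem tail {f : α → List Bool} (hf : PT f) : PT fun a => (f a).tail := by
  obtain ⟨T, _, p, q, h⟩ := hf
  refine ⟨T, inferInstance, .seq p (.pop (.inr (.inl ()))), q + 1, fun a => ?_⟩
  obtain ⟨n, hn, h⟩ := h a
  refine ⟨n + 1, by simpa using hn, .seq h ((Exec.pop _ _).cast rfl ?_)⟩
  refine Stacks.set_eq rfl ?_
  rintro (k | k | k) <;> first | exact .inr rfl | exact .inl rfl

theorem headD {f : α → List Bool} (hf : PT f) : PT fun a => (f a).headD false := by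
  suffices h : PT fun l : List Bool => l.headD false from h.comp hf
  refine ⟨Unit, inferInstance, .ite (.inl ()) (.push (.inr (.inl ())) true)
    (.push (.inr (.inl ())) false), 2, fun l => ⟨1 + 1, by simp, ?_⟩⟩
  by_cases h : l.head? = some true
  · refine .ite_true h ((Exec.push _ _ _).cast rfl ?_)
    refine Stacks.set_eq ?_ ?_
    · simp [enc, h]
    rintro (k | k | k) <;> first | exact .inr rfl | exact .inl rfl
  · refine .ite_false h ((Exec.push _ _ _).cast rfl ?_)
    have : l.headD false = false := by
      rcases l with _ | ⟨_ | _, l⟩ <;> simp_all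
    refine Stacks.set_eq ?_ ?_
    · simpa [enc] using this
    rintro (k | k | k) <;> first | exact .inr rfl | exact .inl rfl

theorem cons {b : α → Bool} {f : α → List Bool} (hb : PT b) (hf : PT f) :
    PT fun a => b a :: f a :=
  (hb.cond (hf.push true) (hf.push false)).congr fun a => by cases b a <;> rfl

theorem not {f : α → Bool} (hf : PT f) : PT fun a => !f a :=
  (hf.cond (const_bool false) (const_bool true)).congr fun a => by cases f a <;> rfl

theorem and {f g : α → Bool} (hf : PT f) (hg : PT g) : PT fun a => f a && g a :=
  (hf.cond hg (const_bool false)).congr fun a => by cases f a <;> rfl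

theorem succ {f : α → ℕ} (hf : PT f) : PT fun a => f a + 1 :=
  nat_of_list (hf.replicate.push true)

theorem pred {f : α → ℕ} (hf : PT f) : PT fun a => f a - 1 :=
  nat_of_list (hf.replicate.tail.congr fun a => by simp)

theorem pos {f : α → ℕ} (hf : PT f) : PT fun a => decide (0 < f a) :=
  hf.replicate.headD.congr fun a => by cases f a <;> simp [List.replicate_succ]

end PT

/-- A function on bit strings in `PT` is computed by a Turing machine in polynomial time. -/
theorem PT.tm2ComputableInPolyTime {f : List Bool → Bool} (hf : PT f) :
    Nonempty (Turing.TM2ComputableInPolyTime (id : List Bool → List Bool)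
      Computability.encodeBool f) := by
  obtain ⟨T, _, p, q, hf⟩ := hf
  refine tm2ComputableInPolyTime_of_exec (K := Unit ⊕ Unit ⊕ T) (.inl ()) (.inr (.inl ()))
    -- The machine must halt with nothing but the output on its stacks, so the preserved input is
    -- erased.
    (.seq p (.drain (.inl ()) .nop .nop)) (q + (1 + 2 * Polynomial.X)) f fun w => ?_
  obtain ⟨n, hn, h⟩ := hf w
  have e1 : regs (ι := Unit) (ο := Unit) T (enc w) (fun _ => []) =
      Stacks.set (fun _ => []) (.inl ()) w := by
    refine (Stacks.set_eq rfl ?_).symm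
    rintro (k | k | k) <;> first | exact .inr rfl | exact .inl rfl
  have e2 : (regs (ι := Unit) (ο := Unit) T (enc w) (enc (f w))).set (.inl ()) [] =
      Stacks.set (fun _ => []) (.inr (.inl ())) [f w] := by
    refine Stacks.set_eq ?_ ?_
    · simp [Stacks.set_apply]
    · rintro (k | k | k)
      · exact .inl rfl
      · exact .inr (Stacks.set_same _ _ _)
      · exact .inr (by simp [Stacks.set_apply])
  refine ⟨n + (1 + 2 * w.length), ?_, .seq (e1 ▸ h) (e2 ▸ exec_clear _ w _ rfl)⟩
  rw [size_list] at hn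
  simp only [Polynomial.eval_add, Polynomial.eval_mul, Polynomial.eval_one, Polynomial.eval_X,
    Polynomial.eval_ofNat]
  omega

end PossibleManipulators

namespace PossibleManipulators

/-- `PTP P`: the predicate `P` is decidable in polynomial time. -/
def PTP {α : Type} [Dat α] (P : α → Prop) : Prop := ∃ b : α → Bool, PT b ∧ ∀ a, b a = true ↔ P a

variable {α β γ σ : Type} [Dat α] [Dat β] [Dat γ] [Dat σ]

/-! ### Iteration and arithmetic. -/

namespace PT

/-- A fold over the unary notation of `n a` that ignores the bits. -/
theorem iterate {n : α → ℕ} {init : α → σ} {step : α → σ → σ} (hn : PT n) (hi : PT init)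
    (hs : PT fun x : α × σ => step x.1 x.2) (B : Polynomial ℕ)
    (hB : ∀ a i, i ≤ n a → size ((step a)^[i] (init a)) ≤ B.eval (size a)) :
    PT fun a => (step a)^[n a] (init a) := by
  have key : ∀ a i, (List.replicate i true).foldl (fun s (_ : Bool) => step a s) (init a) =
      (step a)^[i] (init a) := by
    intro a i
    generalize init a = s
    induction i generalizing s with
    | zero => rfl
    | succ i ih => rw [List.replicate_succ, List.foldl_cons, ih, Function.iterate_succ_apply]
  refine (foldl (step := fun a s _ => step a s) hn.replicate hi
    (hs.comp (PT.fst (β := Bool))) B ?_).congr fun a => key a _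
  intro a l' hl'
  obtain ⟨hl, h⟩ := List.prefix_replicate_iff.1 hl'
  rw [h, key]
  exact hB a _ hl

theorem add {f g : α → ℕ} (hf : PT f) (hg : PT g) : PT fun a => f a + g a := by
  obtain ⟨q, hq⟩ := hf.exists_size_le
  obtain ⟨r, hr⟩ := hg.exists_size_le
  have key : ∀ a i, (fun n => n + 1)^[i] (f a) = f a + i := fun a i => by
    rw [Nat.succ_iterate]
  refine (iterate (step := fun _ n => n + 1) hg hf PT.snd.succ (q + r) ?_).congr fun a => key a _
  intro a i hi
  have h1 := hq a
  have h2 := hr a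
  rw [key, Polynomial.eval_add]
  simp only [size_nat] at *
  omega

theorem sub {f g : α → ℕ} (hf : PT f) (hg : PT g) : PT fun a => f a - g a := by
  obtain ⟨q, hq⟩ := hf.exists_size_le
  have key : ∀ a i, (fun n => n - 1)^[i] (f a) = f a - i := fun a i => by
    induction i with
    | zero => rfl
    | succ i ih => rw [Function.iterate_succ_apply', ih, Nat.sub_sub]
  refine (iterate (step := fun _ n => n - 1) hg hf PT.snd.pred q ?_).congr fun a => key a _
  intro a i hi
  have h1 := hq a
  rw [key]
  simp only [size_nat] at *
  omega

theorem mul {f g : α → ℕ} (hf : PT f) (hg : PT g) : PT fun a => f a * g a := by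
  obtain ⟨q, hq⟩ := hf.exists_size_le
  obtain ⟨r, hr⟩ := hg.exists_size_le
  have key : ∀ a i, (fun n => n + f a)^[i] 0 = f a * i := fun a i => by
    induction i with
    | zero => rfl
    | succ i ih => rw [Function.iterate_succ_apply', ih, Nat.mul_succ]
  refine (iterate (step := fun a n => n + f a) hg (const_nat 0)
    (PT.snd.add (hf.comp PT.fst)) (q * r) ?_).congr fun a => key a _
  intro a i hi
  have h1 := hq a
  have h2 := hr a
  rw [key, Polynomial.eval_mul]
  simp only [size_nat] at *
  exact Nat.mul_le_mul h1 (hi.trans h2)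

end PT

/-! ### Polynomial-time predicates and their Boolean combinations. -/

namespace PTP

theorem decide {P : α → Prop} [DecidablePred P] (h : PTP P) : PT fun a => decide (P a) := by
  obtain ⟨b, hb, h⟩ := h
  exact hb.congr fun a => by simp [← h]

theorem congr {P Q : α → Prop} (hP : PTP P) (h : ∀ a, P a ↔ Q a) : PTP Q := by
  rwa [← funext fun a => propext (h a)]

theorem comp {P : β → Prop} (hP : PTP P) {f : α → β} (hf : PT f) : PTP fun a => P (f a) := by
  obtain ⟨b, hb, h⟩ := hP
  exact ⟨_, hb.comp hf, fun a => h _⟩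

theorem lt {f g : α → ℕ} (hf : PT f) (hg : PT g) : PTP fun a => f a < g a :=
  ⟨_, (hg.sub hf).pos, fun a => by simp⟩

theorem not {P : α → Prop} (hP : PTP P) : PTP fun a => ¬P a := by
  obtain ⟨b, hb, h⟩ := hP
  exact ⟨_, hb.not, fun a => by simp [← h]⟩

theorem and {P Q : α → Prop} (hP : PTP P) (hQ : PTP Q) : PTP fun a => P a ∧ Q a := by
  obtain ⟨b, hb, h⟩ := hP
  obtain ⟨c, hc, h'⟩ := hQ
  exact ⟨_, hb.and hc, fun a => by simp [← h, ← h']⟩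

theorem or {P Q : α → Prop} (hP : PTP P) (hQ : PTP Q) : PTP fun a => P a ∨ Q a :=
  (hP.not.and hQ.not).not.congr fun a => by tauto

theorem imp {P Q : α → Prop} (hP : PTP P) (hQ : PTP Q) : PTP fun a => P a → Q a :=
  (hP.and hQ.not).not.congr fun a => by tauto

theorem le {f g : α → ℕ} (hf : PT f) (hg : PT g) : PTP fun a => f a ≤ g a :=
  (lt hg hf).not.congr fun a => by simp

theorem eq {f g : α → ℕ} (hf : PT f) (hg : PT g) : PTP fun a => f a = g a :=
  ((le hf hg).and (le hg hf)).congr fun a => by omega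

theorem ne {f g : α → ℕ} (hf : PT f) (hg : PT g) : PTP fun a => f a ≠ g a := (eq hf hg).not

theorem bool {f : α → Bool} (hf : PT f) : PTP fun a => f a = true := ⟨f, hf, fun _ => Iff.rfl⟩

end PTP

/-! ### Counting, tabulating and list access. -/

namespace PT

theorem ite {P : α → Prop} [DecidablePred P] {f g : α → β} (hP : PTP P) (hf : PT f) (hg : PT g) :
    PT fun a => if P a then f a else g a :=
  (hP.decide.cond hf hg).congr fun a => by by_cases h : P a <;> simp [h]

theorem count {n : α → ℕ} {P : α → ℕ → Prop} [∀ a, DecidablePred (P a)]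
    (hP : PTP fun x : α × ℕ => P x.1 x.2) (hn : PT n) : PT fun a => Nat.count (P a) (n a) := by
  obtain ⟨q, hq⟩ := hn.exists_size_le
  -- The loop state is the pair of the current index and the count so far.
  have key : ∀ a i, (fun x : ℕ × ℕ => (x.1 + 1, if P a x.1 then x.2 + 1 else x.2))^[i] (0, 0) =
      (i, Nat.count (P a) i) := fun a i => by
    induction i with
    | zero => rfl
    | succ i ih =>
      rw [Function.iterate_succ_apply', ih, Nat.count_succ]
      by_cases h : P a i <;> simp [h]
  let _ : ∀ x : α × ℕ × ℕ, Decidable (P x.1 x.2.1) := fun x => inferInstance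
  refine (PT.snd.comp (iterate (step := fun a (x : ℕ × ℕ) =>
    (x.1 + 1, if P a x.1 then x.2 + 1 else x.2)) hn
    ((const_nat 0).pair (const_nat 0)) ((PT.fst.comp PT.snd).succ.pair
    (ite (P := fun x : α × ℕ × ℕ => P x.1 x.2.1)
      (hP.comp (PT.fst.pair (PT.fst.comp PT.snd))) (PT.snd.comp PT.snd).succ
      (PT.snd.comp PT.snd))) (q + q) ?_)).congr fun a => by rw [key]
  intro a i hi
  have h1 := hq a
  have h2 := Nat.count_le (p := P a) (n := i)
  rw [key, Polynomial.eval_add]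
  simp only [size_nat, size_prod] at *
  omega

theorem table {n : α → ℕ} {P : α → ℕ → Prop} [∀ a, DecidablePred (P a)]
    (hP : PTP fun x : α × ℕ => P x.1 x.2) (hn : PT n) :
    PT fun a => (List.range (n a)).map fun i => decide (P a i) := by
  obtain ⟨q, hq⟩ := hn.exists_size_le
  -- Lists grow at the head, so the table is built from the last index downwards. The invariant is
  -- claimed only for `i ≤ n a`, as the truncated index stays at 0 afterwards.
  have key : ∀ a i, (fun x : ℕ × List Bool => (x.1 - 1, decide (P a (x.1 - 1)) :: x.2))^[i]
      (n a, []) = (n a - i, (List.range' (n a - i) (min i (n a))).map fun j => decide (P a j)) ∨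
      n a < i := fun a i => by
    induction i with
    | zero => simp
    | succ i ih =>
      by_cases h : n a < i + 1
      · exact Or.inr h
      · left
        rw [Function.iterate_succ_apply', ih.resolve_right (by omega), min_eq_left (by omega),
          min_eq_left (by omega), List.range'_succ, Nat.sub_sub,
          show n a - (i + 1) + 1 = n a - i by omega]
        simp
  refine (PT.snd.comp (iterate (step := fun a (x : ℕ × List Bool) =>
    (x.1 - 1, decide (P a (x.1 - 1)) :: x.2)) hn (hn.pair (const_list []))
    ((PT.fst.comp PT.snd).pred.pair (cons (PTP.decide (P := fun x : α × ℕ × List Bool =>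
      P x.1 (x.2.1 - 1)) (hP.comp (PT.fst.pair (PT.fst.comp PT.snd).pred)))
      (PT.snd.comp PT.snd))) (q + q) ?_)).congr fun a => ?_
  · intro a i hi
    have h1 := hq a
    rw [(key a i).resolve_right (by omega), Polynomial.eval_add]
    simp only [size_nat, size_prod, size_list, List.length_map, List.length_range'] at *
    omega
  · rw [(key a (n a)).resolve_right (by omega)]
    simp [List.range_eq_range']

/-- Dropping the head `i a` times brings the entry to the top. Past the end the list is empty and
its `headD` is the same default `false`. -/
theorem getD {l : α → List Bool} {i : α → ℕ} (hl : PT l) (hi : PT i) :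
    PT fun a => (l a).getD (i a) false := by
  obtain ⟨q, hq⟩ := hl.exists_size_le
  have key : ∀ a i, List.tail^[i] (l a) = (l a).drop i := fun a i => by
    induction i with
    | zero => rfl
    | succ i ih => rw [Function.iterate_succ_apply', ih, List.tail_drop]
  refine (headD (iterate (step := fun _ l => l.tail) hi hl PT.snd.tail q ?_)).congr fun a => ?_
  · intro a i _
    have h1 := hq a
    change size (List.tail^[i] (l a)) ≤ _
    rw [key]
    simp only [size_list, List.length_drop] at *
    omega
  · change (List.tail^[i a] (l a)).headD false = _
    rw [key]
    simp [List.getD_eq_getElem?_getD, List.head?_drop]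

end PT

/-! ### Bounded quantifiers. -/

namespace PTP

/-- A witness below `n a` exists if and only if the number of witnesses is positive. -/
theorem exists_lt {n : α → ℕ} {P : α → ℕ → Prop} (hn : PT n)
    (hP : PTP fun x : α × ℕ => P x.1 x.2) : PTP fun a => ∃ i < n a, P a i := by
  classical
  refine (lt (PT.const_nat 0) (PT.count hP hn)).congr fun a => ?_
  rw [Nat.count_eq_card_filter_range, Finset.card_pos]
  simp [Finset.Nonempty]

theorem forall_lt {n : α → ℕ} {P : α → ℕ → Prop} (hn : PT n)
    (hP : PTP fun x : α × ℕ => P x.1 x.2) : PTP fun a => ∀ i < n a, P a i :=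
  (exists_lt (P := fun a i => ¬P a i) hn hP.not).not.congr fun a => by simp

end PTP

end PossibleManipulators

namespace PossibleManipulators

/-! ### Characterizations of the maximin winner -/

theorem Vote.prefers_or_prefers {m : ℕ} (v : Vote m) {a b : Fin m} (h : a ≠ b) :
    v.Prefers a b ∨ v.Prefers b a :=
  lt_or_gt_of_ne fun h' => h (v.symm.injective h')

theorem Vote.Prefers.not_prefers {m : ℕ} {v : Vote m} {a b : Fin m} (h : v.Prefers a b) :
    ¬v.Prefers b a := lt_asymm h

theorem numPrefer_add_numPrefer {m n : ℕ} (P : Profile m n) {a b : Fin m} (h : a ≠ b) :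
    numPrefer P a b + numPrefer P b a = n := by
  have e : (Finset.univ.filter fun i => (P i).Prefers b a) =
      Finset.univ.filter fun i => ¬(P i).Prefers a b := by
    refine Finset.filter_congr fun i _ => ⟨fun h => h.not_prefers, fun h' => ?_⟩
    exact ((P i).prefers_or_prefers h).resolve_left h'
  rw [numPrefer, numPrefer, e, Finset.card_filter_add_card_filter_not, Finset.card_univ,
    Fintype.card_fin]

/-- All margins are the same increasing function of the pairwise counts, so scores can be compared
through natural numbers. -/
theorem margin_eq {m n : ℕ} (P : Profile m n) {a b : Fin m} (h : a ≠ b) :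
    margin P a b = 2 * numPrefer P a b - n := by
  have := numPrefer_add_numPrefer P h
  rw [margin]
  omega

/-- The second candidate `b` makes the minimum range over a nonempty set, so it is attained and
differs from `⊤`. The minimizer is the same for margins and for counts. -/
theorem exists_maximinScore_eq {m n : ℕ} (P : Profile m n) {a b : Fin m} (h : b ≠ a) :
    ∃ c ≠ a, maximinScore P a = margin P a c ∧ ∀ d ≠ a, numPrefer P a c ≤ numPrefer P a d := by
  obtain ⟨c, hc, hmin⟩ := Finset.exists_min_image (Finset.univ.erase a) (numPrefer P a)
    ⟨b, Finset.mem_erase.2 ⟨h, Finset.mem_univ b⟩⟩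
  have hca := (Finset.mem_erase.1 hc).1
  refine ⟨c, hca, le_antisymm (Finset.inf_le hc) (Finset.le_inf fun d hd => ?_),
    fun d hd => hmin d (Finset.mem_erase.2 ⟨hd, Finset.mem_univ d⟩)⟩
  have h1 := hmin d hd
  rw [margin_eq P hca.symm, margin_eq P (Finset.mem_erase.1 hd).1.symm]
  exact_mod_cast (by omega : (2 * numPrefer P a c - n : ℤ) ≤ 2 * numPrefer P a d - n)

theorem tieBreak_eq_iff {m : ℕ} (t : Vote m) (S : {S : Finset (Fin m) // S.Nonempty}) (x : Fin m) :
    tieBreak t S = x ↔ x ∈ S.1 ∧ ∀ b ∈ S.1, t.symm x ≤ t.symm b := by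
  have h1 := Finset.min'_mem _ (S.2.image t.symm)
  have h3 : t.symm (tieBreak t S) = (S.1.image t.symm).min' (S.2.image t.symm) := by
    rw [tieBreak, Equiv.symm_apply_apply]
  have h4 : tieBreak t S ∈ S.1 := by
    obtain ⟨b, hb, e⟩ := Finset.mem_image.1 h1
    rw [tieBreak, ← e, Equiv.apply_symm_apply]
    exact hb
  have h2 : ∀ b ∈ S.1, t.symm (tieBreak t S) ≤ t.symm b := fun b hb =>
    h3.le.trans (Finset.min'_le _ _ (Finset.mem_image_of_mem t.symm hb))
  constructor
  · rintro rfl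
    exact ⟨h4, h2⟩
  · rintro ⟨hx, h⟩
    exact t.symm.injective (le_antisymm (h2 x hx) (h _ h4))

theorem replaceVotes_singleton {m n : ℕ} (P : Profile m n) (j : Fin n)
    (Q : ({j} : Finset (Fin n)) → Vote m) :
    replaceVotes P {j} Q = Function.update P j (Q ⟨j, Finset.mem_singleton_self j⟩) := by
  funext i
  by_cases h : i = j
  · subst h
    simp [replaceVotes]
  · simp [replaceVotes, h]

theorem not_isCoalitionAgainst_empty {m n : ℕ} (r : Profile m n → Fin m) (P : Profile m n)
    (y : Fin m) : ¬IsCoalitionAgainst r P ∅ y := by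
  rintro ⟨hy, Q, -, h⟩
  exact hy h.symm

/-- A set of at most one voter is empty or a singleton, and the empty set leaves the winner
unchanged. -/
theorem exists_isCoalitionAgainst_iff {m n : ℕ} [NeZero n] (r : Profile m n → Fin m)
    (P : Profile m n) (y : Fin m) :
    (∃ M : Finset (Fin n), M.card ≤ 1 ∧ IsCoalitionAgainst r P M y) ↔
      ∃ j, IsCoalitionAgainst r P {j} y := by
  constructor
  · rintro ⟨M, hM, h⟩
    rcases Finset.card_le_one_iff_subset_singleton.1 hM with ⟨j, hj⟩
    rcases Finset.subset_singleton_iff.1 hj with rfl | rfl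
    · exact absurd h (not_isCoalitionAgainst_empty _ _ _)
    · exact ⟨j, h⟩
  · rintro ⟨j, h⟩
    exact ⟨{j}, by simp, h⟩

variable {m n : ℕ} [NeZero m] [NeZero n]

/-- `x` wins if each rival `b` has a smaller score, where equality is allowed if the tie-breaking
order prefers `x`; adding 1 turns `<` into `≤`. That the minimum for `b` is below the minimum for
`x` means that one count of `b` is below all counts of `x`. -/
theorem winner_maximin_eq_iff (t : Vote m) (P : Profile m n) (x : Fin m) :
    winner maximin t P = x ↔ ∀ b ≠ x, ∃ c ≠ b, ∀ d ≠ x,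
      numPrefer P b c < numPrefer P x d + if t.Prefers x b then 1 else 0 := by
  have key : winner maximin t P = x ↔ ∀ b ≠ x, maximinScore P b ≤ maximinScore P x ∧
      (¬t.Prefers x b → maximinScore P b < maximinScore P x) := by
    rw [winner, tieBreak_eq_iff]
    simp only [maximin, maximinWinners, Finset.mem_filter, Finset.mem_univ, true_and]
    constructor
    · rintro ⟨h1, h2⟩ b hb
      refine ⟨h1 b, fun h => lt_of_le_of_ne (h1 b) fun e => h ?_⟩
      exact lt_of_le_of_ne (h2 b fun c => e ▸ h1 c) fun e => hb (t.symm.injective e).symm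
    · intro h
      refine ⟨fun b => ?_, fun b hb => ?_⟩
      · by_cases e : b = x
        · rw [e]
        · exact (h b e).1
      · by_cases e : b = x
        · rw [e]
        · by_contra h'
          exact absurd ((h b e).2 fun h'' => h' h''.le) (not_lt.2 (hb x))
  rw [key]
  refine forall₂_congr fun b hb => ?_
  obtain ⟨c, hc, ec, hc'⟩ := exists_maximinScore_eq P (Ne.symm hb)
  obtain ⟨d, hd, ed, hd'⟩ := exists_maximinScore_eq P hb
  rw [ec, ed, WithTop.coe_le_coe, WithTop.coe_lt_coe, margin_eq P hc.symm, margin_eq P hd.symm]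
  constructor
  · rintro ⟨h1, h2⟩
    refine ⟨c, hc, fun d' hd'' => ?_⟩
    have := hd' d' hd''
    split_ifs with h
    · omega
    · have := h2 h
      omega
  · rintro ⟨c', hc'', h⟩
    have h1 := h d hd
    have h2 := hc' c' hc''
    split_ifs at h1 with h'
    · exact ⟨by omega, fun h => absurd h' h⟩
    · exact ⟨by omega, fun _ => by omega⟩

/-- The threshold `s` separates the condition on `y` from those on its rivals. The minimum count of
`y` serves as `s`, which explains the bound `n`. -/
theorem winner_maximin_eq_iff_exists (t : Vote m) (P : Profile m n) {x y : Fin m} (hxy : x ≠ y) :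
    winner maximin t P = y ↔ ∃ s ≤ n, (∀ d ≠ y, s ≤ numPrefer P y d) ∧
      ∀ b ≠ y, ∃ c ≠ b, numPrefer P b c < s + if t.Prefers y b then 1 else 0 := by
  rw [winner_maximin_eq_iff]
  constructor
  · intro h
    obtain ⟨d, hd, -, hd'⟩ := exists_maximinScore_eq P hxy
    refine ⟨numPrefer P y d, ?_, hd', fun b hb => ?_⟩
    · have := numPrefer_add_numPrefer P hd
      omega
    · obtain ⟨c, hc, h⟩ := h b hb
      exact ⟨c, hc, h d hd⟩
  · rintro ⟨s, -, h1, h2⟩ b hb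
    obtain ⟨c, hc, h⟩ := h2 b hb
    exact ⟨c, hc, fun d hd => h.trans_le (Nat.add_le_add_right (h1 d hd) _)⟩

/-! ### Manipulation by a single voter -/

/-- The number of voters other than `j` who prefer `a` to `b`. -/
def numOthers {m n : ℕ} (P : Profile m n) (j : Fin n) (a b : Fin m) : ℕ :=
  (Finset.univ.filter fun i => i ≠ j ∧ (P i).Prefers a b).card

theorem numPrefer_update {m n : ℕ} (P : Profile m n) (j : Fin n) (v : Vote m) (a b : Fin m) :
    numPrefer (Function.update P j v) a b =
      numOthers P j a b + if v.Prefers a b then 1 else 0 := by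
  rw [numPrefer, ← Finset.card_filter_add_card_filter_not (s := Finset.univ.filter _)
    (fun i => i ≠ j), Finset.filter_filter, Finset.filter_filter, numOthers]
  congr 1
  · congr 1
    refine Finset.filter_congr fun i _ => ?_
    constructor
    · rintro ⟨h1, h2⟩
      rw [Function.update_of_ne h2] at h1
      exact ⟨h2, h1⟩
    · rintro ⟨h2, h1⟩
      refine ⟨?_, h2⟩
      rwa [Function.update_of_ne h2]
  · by_cases h : v.Prefers a b
    · rw [if_pos h, Finset.card_eq_one]
      refine ⟨j, Finset.ext fun i => ?_⟩
      simp only [Finset.mem_filter, Finset.mem_univ, true_and, not_not, Finset.mem_singleton]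
      refine ⟨And.right, ?_⟩
      rintro rfl
      simpa using h
    · rw [if_neg h, Finset.card_eq_zero, Finset.filter_eq_empty_iff]
      rintro i - ⟨h1, h2⟩
      rw [not_not] at h2
      subst h2
      simp at h1
      exact h h1

/-- The candidate `a` may be ranked directly below the candidates in `T`, if the manipulator wants
to keep `x` above `y`, to let every pairwise count of `y` be at least `s`, and to let some pairwise
count of every other candidate `b` be less than `θ b`. -/
def Placeable {m : ℕ} (N : Fin m → Fin m → ℕ) (x y : Fin m) (s : ℕ) (θ : Fin m → ℕ)
    (T : Set (Fin m)) (a : Fin m) : Prop :=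
  (a = y → x ∈ T) ∧ (a ≠ y → N y a < s → y ∈ T) ∧
    (a ≠ y → ∃ b ≠ a, (b ∈ T ∧ N a b < θ a) ∨ N a b + 1 < θ a)

/-- The set `T` occurs only positively. This is why placing candidates early cannot block others. -/
theorem Placeable.mono {m : ℕ} {N : Fin m → Fin m → ℕ} {x y : Fin m} {s : ℕ} {θ : Fin m → ℕ}
    {T T' : Set (Fin m)} (h : T ⊆ T') {a : Fin m} (ha : Placeable N x y s θ T a) :
    Placeable N x y s θ T' a := by
  refine ⟨fun e => h (ha.1 e), fun e e' => h (ha.2.1 e e'), fun e => ?_⟩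
  obtain ⟨b, hb, hb'⟩ := ha.2.2 e
  exact ⟨b, hb, hb'.imp_left fun h' => ⟨h h'.1, h'.2⟩⟩

/-- The candidates placed after `k` rounds of greedily placing all placeable candidates. -/
def placed {m : ℕ} (N : Fin m → Fin m → ℕ) (x y : Fin m) (s : ℕ) (θ : Fin m → ℕ) :
    ℕ → Set (Fin m)
  | 0 => ∅
  | k + 1 => {a | Placeable N x y s θ (placed N x y s θ k) a}

/-- Greedy exchange argument. A good vote itself shows that the candidate at position `p` is placed
after `p + 1` rounds. Conversely, ranking candidates by the round in which they are first placed
puts above each one everything that its placement relied on. The bound `s ≤ N y d + 1` is separate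
because no ranking can add more than 1. -/
theorem exists_vote_iff_placed {m : ℕ} (N : Fin m → Fin m → ℕ) {x y : Fin m} (s : ℕ)
    (θ : Fin m → ℕ) :
    (∃ v : Vote m, v.Prefers x y ∧ (∀ d ≠ y, s ≤ N y d + if v.Prefers y d then 1 else 0) ∧
      ∀ b ≠ y, ∃ c ≠ b, (N b c + if v.Prefers b c then 1 else 0) < θ b) ↔
    (∀ d ≠ y, s ≤ N y d + 1) ∧ ∀ a, a ∈ placed N x y s θ m := by
  constructor
  · rintro ⟨v, hv, h1, h2⟩
    refine ⟨fun d hd => (h1 d hd).trans ?_, fun a => ?_⟩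
    · split_ifs <;> omega
    -- Induction on the number of rounds: all candidates above `a` in `v` have been placed one round
    -- earlier.
    · have key : ∀ k a, (v.symm a : ℕ) < k → a ∈ placed N x y s θ k := by
        intro k
        induction k with
        | zero => intro a ha; omega
        | succ k ih =>
          intro a ha
          have ih' : ∀ b, v.Prefers b a → b ∈ placed N x y s θ k := fun b hb =>
            ih b (by have : (v.symm b : ℕ) < v.symm a := hb; omega)
          refine ⟨fun e => ih' x (e ▸ hv), fun e e' => ih' y ?_, fun e => ?_⟩
          · by_contra h
            have := h1 a e
            rw [if_neg h] at this
            omega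
          · obtain ⟨c, hc, h⟩ := h2 a e
            refine ⟨c, hc, ?_⟩
            rcases v.prefers_or_prefers hc with h' | h'
            · exact Or.inl ⟨ih' c h', by omega⟩
            · rw [if_pos h'] at h
              exact Or.inr h
      exact key m a (v.symm a).2
  · rintro ⟨h1, h2⟩
    classical
    have hex : ∀ a, ∃ k, a ∈ placed N x y s θ k := fun a => ⟨m, h2 a⟩
    -- The first round in which `a` is placed; it is never 0, as nothing is placed then.
    let st : Fin m → ℕ := fun a => Nat.find (hex a)
    have hst : ∀ a, Placeable N x y s θ {b | st b < st a} a := by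
      intro a
      have h := Nat.find_spec (hex a)
      obtain ⟨k, hk⟩ : ∃ k, Nat.find (hex a) = k + 1 := by
        refine Nat.exists_eq_succ_of_ne_zero fun e => ?_
        rw [e] at h
        exact h
      rw [hk] at h
      refine Placeable.mono (fun b hb => ?_) h
      have : st b ≤ k := Nat.find_min' (hex b) hb
      change st b < Nat.find (hex a)
      omega
    -- Candidates of the same round may be ordered arbitrarily: by `hst` each relies only on
    -- strictly earlier rounds.
    let v : Vote m := Tuple.sort st
    have hv : ∀ {a b}, st a < st b → v.Prefers a b := by
      intro a b h
      by_contra h'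
      have := Tuple.monotone_sort st (not_lt.1 h')
      simp only [Function.comp_apply] at this
      change st (v (v.symm b)) ≤ st (v (v.symm a)) at this
      rw [Equiv.apply_symm_apply, Equiv.apply_symm_apply] at this
      omega
    refine ⟨v, hv ((hst y).1 rfl), fun d hd => ?_, fun b hb => ?_⟩
    · by_cases h : N y d < s
      · rw [if_pos (hv ((hst d).2.1 hd h))]
        exact h1 d hd
      · omega
    · obtain ⟨c, hc, ⟨h, h'⟩ | h⟩ := (hst b).2.2 hb
      · refine ⟨c, hc, ?_⟩
        rw [if_neg (hv h).not_prefers]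
        exact h'
      · refine ⟨c, hc, lt_of_le_of_lt ?_ h⟩
        split_ifs <;> omega

theorem exists_vote_winner_iff (t : Vote m) (P : Profile m n) (j : Fin n) {x y : Fin m}
    (hxy : x ≠ y) :
    (∃ v : Vote m, v.Prefers x y ∧ winner maximin t (Function.update P j v) = y) ↔
      ∃ s < n + 1, (∀ d ≠ y, s ≤ numOthers P j y d + 1) ∧
        ∀ a, a ∈ placed (numOthers P j) x y s
          (fun b => s + if t.Prefers y b then 1 else 0) m := by
  simp only [← exists_vote_iff_placed, winner_maximin_eq_iff_exists t _ hxy, numPrefer_update,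
    Nat.lt_succ_iff]
  constructor
  · rintro ⟨v, hv, s, hs, h⟩
    exact ⟨s, hs, v, hv, h⟩
  · rintro ⟨s, hs, v, hv, h⟩
    exact ⟨v, hv, s, hs, h⟩

/-- The current winner is introduced as a variable `x`, so that the right side uses only searches
over candidates and thresholds. -/
theorem isCoalitionAgainst_singleton_iff (t : Vote m) (P : Profile m n) (j : Fin n) (y : Fin m) :
    IsCoalitionAgainst (winner maximin t) P {j} y ↔ ∃ x, winner maximin t P = x ∧ x ≠ y ∧
      ∃ s < n + 1, (∀ d ≠ y, s ≤ numOthers P j y d + 1) ∧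
        ∀ a, a ∈ placed (numOthers P j) x y s
          (fun b => s + if t.Prefers y b then 1 else 0) m := by
  constructor
  · rintro ⟨hy, Q, hQ, h⟩
    rw [replaceVotes_singleton] at h
    exact ⟨_, rfl, hy.symm, (exists_vote_winner_iff t P j hy.symm).1 ⟨_, hQ _, h⟩⟩
  · rintro ⟨x, rfl, hy, h⟩
    obtain ⟨v, hv, h⟩ := (exists_vote_winner_iff t P j hy).2 h
    exact ⟨hy.symm, fun _ => v, fun _ => hv, by rwa [replaceVotes_singleton]⟩

end PossibleManipulators

namespace PossibleManipulators

/-! ### Reading the input -/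

/-- One step of looking up a number in a list of numbers in unary notation: the state consists of
the number of separators that are left to read (plus one) and of the value read so far. -/
def entryStep (c : ℕ × ℕ) (b : Bool) : ℕ × ℕ :=
  if b = true then (c.1, if c.1 = 1 then c.2 + 1 else c.2) else (c.1 - 1, c.2)

/-- The entry with index `j` of the list of numbers encoded by `w`. -/
def entry (w : List Bool) (j : ℕ) : ℕ := (w.foldl entryStep (j + 1, 0)).2

theorem foldl_entryStep_replicate (k c v : ℕ) :
    (List.replicate k true).foldl entryStep (c, v) = (c, if c = 1 then v + k else v) := by
  induction k generalizing v with
  | zero => simp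
  | succ k ih =>
    rw [List.replicate_succ, List.foldl_cons, entryStep, if_pos rfl, ih]
    split_ifs <;> simp; omega

/-- Ones are added only while the counter is 1, that is, inside the wanted block. At 0 the truncated
subtraction keeps the counter fixed, so later blocks do not contribute. -/
theorem foldl_entryStep_encodeNats (l : List ℕ) (c v : ℕ) :
    ((encodeNats l).foldl entryStep (c, v)).2 = v + if c = 0 then 0 else l.getD (c - 1) 0 := by
  induction l generalizing c v with
  | nil => simp [encodeNats]
  | cons a l ih =>
    have e : encodeNats (a :: l) = List.replicate a true ++ false :: encodeNats l := by
      simp [encodeNats]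
    rw [e, List.foldl_append, foldl_entryStep_replicate, List.foldl_cons, entryStep,
      if_neg (by simp), ih]
    rcases c with _ | _ | c <;> simp

theorem entry_encodeNats (l : List ℕ) (j : ℕ) : entry (encodeNats l) j = l.getD j 0 := by
  rw [entry, foldl_entryStep_encodeNats]
  simp

theorem count_encodeNats (l : List ℕ) : (encodeNats l).count false = l.length := by
  induction l with
  | nil => rfl
  | cons a l ih =>
    rw [encodeNats] at ih
    simp [encodeNats, ih, List.count_append, List.count_replicate]

/-- Each number ends with a `false`, so the encodings are the empty string and the strings with last
bit `false`. The fold returns the last bit, with `false` for the empty string. -/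
theorem exists_encodeNats_eq_iff (w : List Bool) :
    (∃ l, encodeNats l = w) ↔ w.foldl (fun _ b => b) false = false := by
  have last : ∀ (l : List ℕ) (b : Bool), l ≠ [] ∨ b = false →
      (encodeNats l).foldl (fun _ b => b) b = false := by
    intro l
    induction l with
    | nil => simp [encodeNats]
    | cons a l ih =>
      intro b _
      have e : encodeNats (a :: l) = List.replicate a true ++ false :: encodeNats l := by
        simp [encodeNats]
      rw [e, List.foldl_append, List.foldl_cons]
      exact ih _ (Or.inr rfl)
  constructor
  · rintro ⟨l, rfl⟩
    exact last l _ (Or.inr rfl)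
  -- The initial value `b` stands for the preceding bit: after a `true` the rest must contain a
  -- number that this bit can increment.
  · suffices h : ∀ b, w.foldl (fun _ b => b) b = false →
        ∃ l, encodeNats l = w ∧ (b = true → l ≠ []) by
      intro hw
      obtain ⟨l, hl, -⟩ := h _ hw
      exact ⟨l, hl⟩
    induction w with
    | nil =>
      rintro b rfl
      exact ⟨[], rfl, by simp⟩
    | cons c w ih =>
      intro b h
      obtain ⟨l, hl, hl'⟩ := ih c h
      cases c with
      | false => exact ⟨0 :: l, by rw [← hl]; simp [encodeNats], by simp⟩
      | true =>
        obtain ⟨a, l, rfl⟩ := List.exists_cons_of_ne_nil (hl' rfl)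
        exact ⟨(a + 1) :: l, by rw [← hl]; simp [encodeNats, List.replicate_succ], by simp⟩

/-! ### The algorithm

In the following, `w` encodes a list of numbers that starts with the code of an election. The
ballot with number `0` is the tie-breaking order, and the ballot with number `i + 1` is the vote
of the voter `i`. -/

/-- The candidate at position `p` of the ballot `i`. -/
def ballot (w : List Bool) (i p : ℕ) : ℕ := entry w (2 + i * entry w 0 + p)

/-- `a` is preferred to `b` in the ballot `i`. -/
def Pref (w : List Bool) (i a b : ℕ) : Prop :=
  ∃ p < entry w 0, ∃ q < p, ballot w i q = a ∧ ballot w i p = b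

open Classical in
/-- The number of voters other than `j` who prefer `a` to `b`. -/
noncomputable def countOthers (w : List Bool) (j a b : ℕ) : ℕ :=
  Nat.count (fun i => i ≠ j ∧ Pref w (i + 1) a b) (entry w 1)

open Classical in
/-- The indicator of the preference of `a` to `b` in the tie-breaking order. -/
noncomputable def tieBit (w : List Bool) (a b : ℕ) : ℕ := if Pref w 0 a b then 1 else 0

/-- `x` is the winner of the election. -/
def IsWinner (w : List Bool) (x : ℕ) : Prop :=
  ∀ b < entry w 0, b ≠ x → ∃ c < entry w 0, c ≠ b ∧ ∀ d < entry w 0, d ≠ x →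
    countOthers w (entry w 1) b c < countOthers w (entry w 1) x d + tieBit w x b

/-- `Placeable`, where the set of candidates is given by its indicator list. -/
def PlaceableCode (w : List Bool) (j x y s : ℕ) (T : List Bool) (a : ℕ) : Prop :=
  (a = y → T.getD x false = true) ∧
  (a ≠ y → countOthers w j y a < s → T.getD y false = true) ∧
  (a ≠ y → ∃ b < entry w 0, b ≠ a ∧
    ((T.getD b false = true ∧ countOthers w j a b < s + tieBit w y a) ∨
      countOthers w j a b + 1 < s + tieBit w y a))

open Classical in
/-- The indicator list of the candidates placed after `k` rounds. -/
noncomputable def placedCode (w : List Bool) (j x y s k : ℕ) : List Bool :=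
  (fun T => (List.range (entry w 0)).map fun a => decide (PlaceableCode w j x y s T a))^[k] []

/-- The voter `j` is a possible manipulator against `y`. -/
def Manip (w : List Bool) (j y : ℕ) : Prop :=
  ∃ x < entry w 0, IsWinner w x ∧ x ≠ y ∧ ∃ s < entry w 1 + 1,
    (∀ d < entry w 0, d ≠ y → s ≤ countOthers w j y d + 1) ∧
    ∀ a < entry w 0, (placedCode w j x y s (entry w 0)).getD a false = true

/-- `w` encodes a list of numbers that starts with the code of an election, up to the length of
the list. -/
def WellFormed (w : List Bool) : Prop :=
  w.foldl (fun _ b => b) false = false ∧ 0 < entry w 0 ∧ 0 < entry w 1 ∧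
    ∀ i < entry w 1 + 1, ∀ p < entry w 0, ballot w i p < entry w 0 ∧
      ∀ q < p, ballot w i q ≠ ballot w i p

/-- The index of the first number that follows the code of the election. -/
def codeLength (w : List Bool) : ℕ := 2 + (entry w 1 + 1) * entry w 0

/-! ### The algorithm runs in polynomial time -/

section PolyTime

variable {α : Type} [Dat α] {W T : α → List Bool} {I J A B X Y S : α → ℕ}

-- The counter never increases and the value grows by at most 1 per bit, which gives the size bound
-- required for the fold.
theorem PT.entry (hW : PT W) (hI : PT I) : PT fun a => entry (W a) (I a) := by
  have key : ∀ (l : List Bool) (c v : ℕ), (l.foldl entryStep (c, v)).1 ≤ c ∧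
      (l.foldl entryStep (c, v)).2 ≤ v + l.length := by
    intro l
    induction l with
    | nil => intro c v; simp
    | cons b l ih =>
      intro c v
      rw [List.foldl_cons, List.length_cons, entryStep]
      split_ifs
      · have := ih c (v + 1); dsimp only at *; omega
      · have := ih c v; dsimp only at *; omega
      · have := ih (c - 1) v; dsimp only at *; omega
  obtain ⟨q, hq⟩ := hW.exists_size_le
  obtain ⟨r, hr⟩ := hI.exists_size_le
  refine PT.snd.comp (PT.foldl (step := fun _ => entryStep) hW (hI.succ.pair (const_nat 0)) ?_
    (r + 1 + q) ?_)
  · have hc : PT fun x : (α × ℕ × ℕ) × Bool => x.1.2.1 := PT.fst.comp (PT.snd.comp PT.fst)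
    have hv : PT fun x : (α × ℕ × ℕ) × Bool => x.1.2.2 := PT.snd.comp (PT.snd.comp PT.fst)
    exact PT.ite (PTP.bool PT.snd) (hc.pair (PT.ite (PTP.eq hc (const_nat 1)) hv.succ hv))
      (hc.pred.pair hv)
  · intro a l' hl'
    have h1 := hq a
    have h2 := hr a
    have h3 := hl'.length_le
    have h4 := key l' (I a + 1) 0
    simp only [size_list, size_nat] at h1 h2
    have e := size_prod (l'.foldl entryStep (I a + 1, 0)).1 (l'.foldl entryStep (I a + 1, 0)).2
    simp only [size_nat] at e
    simp only [Polynomial.eval_add, Polynomial.eval_one]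
    exact e.trans_le (by omega)

theorem PT.count_false (hW : PT W) : PT fun a => (W a).count false := by
  have key : ∀ (l : List Bool) (k : ℕ),
      l.foldl (fun n b => if b = true then n else n + 1) k = k + l.count false := by
    intro l
    induction l with
    | nil => intro k; rfl
    | cons b l ih =>
      intro k
      rw [List.foldl_cons, ih]
      cases b <;> simp; omega
  obtain ⟨q, hq⟩ := hW.exists_size_le
  have hn : PT fun x : (α × ℕ) × Bool => x.1.2 := PT.snd.comp PT.fst
  refine (PT.foldl (step := fun _ n b => if b = true then n else n + 1) hW (const_nat 0)
    (PT.ite (PTP.bool PT.snd) hn hn.succ) q ?_).congr fun a => by rw [key, zero_add]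
  intro a l' hl'
  have h1 := hq a
  have h2 := hl'.length_le
  have h3 := List.count_le_length (a := false) (l := l')
  rw [key]
  simp only [size_list, size_nat] at *
  omega

theorem PT.foldl_last (hW : PT W) : PT fun a => (W a).foldl (fun _ b => b) false :=
  PT.foldl (step := fun _ _ b => b) hW (const_bool false) PT.snd 1 fun a l' _ => by simp

theorem PT.ballot (hW : PT W) (hI : PT I) (hA : PT A) : PT fun a => ballot (W a) (I a) (A a) :=
  hW.entry (((const_nat 2).add (hI.mul (hW.entry (const_nat 0)))).add hA)

theorem PTP.pref (hW : PT W) (hI : PT I) (hA : PT A) (hB : PT B) :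
    PTP fun a => Pref (W a) (I a) (A a) (B a) := by
  have h2 : PT fun x : (α × ℕ) × ℕ => x.1.1 := PT.fst.comp PT.fst
  refine PTP.exists_lt (hW.entry (.const_nat 0)) (PTP.exists_lt PT.snd (.and ?_ ?_))
  · exact PTP.eq (.ballot (hW.comp h2) (hI.comp h2) PT.snd) (hA.comp h2)
  · exact PTP.eq (.ballot (hW.comp h2) (hI.comp h2) (PT.snd.comp PT.fst)) (hB.comp h2)

theorem PT.countOthers (hW : PT W) (hJ : PT J) (hA : PT A) (hB : PT B) :
    PT fun a => countOthers (W a) (J a) (A a) (B a) := by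
  classical
  refine (PT.count (P := fun a i => i ≠ J a ∧ Pref (W a) (i + 1) (A a) (B a)) (.and ?_ ?_)
    (hW.entry (const_nat 1))).congr fun a => ?_
  · exact PTP.ne PT.snd (hJ.comp PT.fst)
  · exact .pref (hW.comp PT.fst) PT.snd.succ (hA.comp PT.fst) (hB.comp PT.fst)
  · unfold PossibleManipulators.countOthers
    congr

theorem PT.tieBit (hW : PT W) (hA : PT A) (hB : PT B) :
    PT fun a => tieBit (W a) (A a) (B a) := by
  classical
  refine (PT.ite (PTP.pref hW (const_nat 0) hA hB) (const_nat 1) (const_nat 0)).congr fun a => ?_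
  unfold PossibleManipulators.tieBit
  congr

theorem PTP.isWinner (hW : PT W) (hX : PT X) : PTP fun a => IsWinner (W a) (X a) := by
  have hn : PT fun a => PossibleManipulators.entry (W a) 1 := hW.entry (.const_nat 1)
  have hm : PT fun a => PossibleManipulators.entry (W a) 0 := hW.entry (.const_nat 0)
  have p2 : PT fun x : (α × ℕ) × ℕ => x.1.1 := PT.fst.comp PT.fst
  have p3 : PT fun x : ((α × ℕ) × ℕ) × ℕ => x.1.1.1 := p2.comp PT.fst
  have hb : PT fun x : ((α × ℕ) × ℕ) × ℕ => x.1.1.2 := PT.snd.comp (PT.fst.comp PT.fst)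
  have hc : PT fun x : ((α × ℕ) × ℕ) × ℕ => x.1.2 := PT.snd.comp PT.fst
  refine .forall_lt hm (.imp (.ne PT.snd (hX.comp PT.fst)) (.exists_lt (hm.comp PT.fst)
    (.and (.ne PT.snd (PT.snd.comp PT.fst)) (.forall_lt (hm.comp p2)
    (.imp (.ne PT.snd (hX.comp p3)) (.lt ?_ (.add ?_ ?_)))))))
  · exact .countOthers (hW.comp p3) (hn.comp p3) hb hc
  · exact .countOthers (hW.comp p3) (hn.comp p3) (hX.comp p3) PT.snd
  · exact .tieBit (hW.comp p3) (hX.comp p3) hb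

theorem PTP.placeableCode (hW : PT W) (hJ : PT J) (hX : PT X) (hY : PT Y) (hS : PT S) (hT : PT T)
    (hA : PT A) :
    PTP fun a => PlaceableCode (W a) (J a) (X a) (Y a) (S a) (T a) (A a) := by
  have hm : PT fun a => PossibleManipulators.entry (W a) 0 := hW.entry (.const_nat 0)
  have h1 : PT fun x : α × ℕ => PossibleManipulators.countOthers (W x.1) (J x.1) (A x.1) x.2 :=
    .countOthers (hW.comp PT.fst) (hJ.comp PT.fst) (hA.comp PT.fst) PT.snd
  have h2 : PT fun x : α × ℕ => S x.1 + PossibleManipulators.tieBit (W x.1) (Y x.1) (A x.1) :=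
    .add (hS.comp PT.fst) (.tieBit (hW.comp PT.fst) (hY.comp PT.fst) (hA.comp PT.fst))
  refine .and (.imp (.eq hA hY) (.bool (hT.getD hX))) (.and (.imp (.ne hA hY)
    (.imp (.lt (.countOthers hW hJ hY hA) hS) (.bool (hT.getD hY)))) (.imp (.ne hA hY)
    (.exists_lt hm (.and (.ne PT.snd (hA.comp PT.fst)) (.or (.and ?_ (.lt h1 h2))
    (.lt h1.succ h2))))))
  exact .bool ((hT.comp PT.fst).getD PT.snd)

theorem PT.placedCode (hW : PT W) (hJ : PT J) (hX : PT X) (hY : PT Y) (hS : PT S) (hI : PT I) :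
    PT fun a => placedCode (W a) (J a) (X a) (Y a) (S a) (I a) := by
  classical
  have hm : PT fun a => PossibleManipulators.entry (W a) 0 := hW.entry (.const_nat 0)
  have p2 : PT fun x : (α × List Bool) × ℕ => x.1.1 := PT.fst.comp PT.fst
  obtain ⟨q, hq⟩ := hm.exists_size_le
  refine (PT.iterate (step := fun a T => (List.range (PossibleManipulators.entry (W a) 0)).map
    fun b => decide (PlaceableCode (W a) (J a) (X a) (Y a) (S a) T b)) hI (const_list [])
    (.table (α := α × List Bool)
      (P := fun x b => PlaceableCode (W x.1) (J x.1) (X x.1) (Y x.1) (S x.1) x.2 b)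
      (.placeableCode (hW.comp p2) (hJ.comp p2) (hX.comp p2) (hY.comp p2) (hS.comp p2)
        (PT.snd.comp PT.fst) PT.snd) (hm.comp PT.fst)) q ?_).congr fun a => ?_
  -- The list is empty at the start and has one bit per candidate after every round.
  · rintro a (_ | i) _
    · simp
    · have := hq a
      rw [Function.iterate_succ_apply']
      simpa using this
  · unfold PossibleManipulators.placedCode
    congr

theorem PTP.manip (hW : PT W) (hJ : PT J) (hY : PT Y) : PTP fun a => Manip (W a) (J a) (Y a) := by
  have hn : PT fun a => PossibleManipulators.entry (W a) 1 := hW.entry (.const_nat 1)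
  have hm : PT fun a => PossibleManipulators.entry (W a) 0 := hW.entry (.const_nat 0)
  have p2 : PT fun x : (α × ℕ) × ℕ => x.1.1 := PT.fst.comp PT.fst
  have p3 : PT fun x : ((α × ℕ) × ℕ) × ℕ => x.1.1.1 := p2.comp PT.fst
  have hx : PT fun x : ((α × ℕ) × ℕ) × ℕ => x.1.1.2 := PT.snd.comp (PT.fst.comp PT.fst)
  have hs : PT fun x : ((α × ℕ) × ℕ) × ℕ => x.1.2 := PT.snd.comp PT.fst
  refine .exists_lt hm (.and (.isWinner (hW.comp PT.fst) PT.snd) (.and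
    (.ne PT.snd (hY.comp PT.fst)) (.exists_lt (hn.comp PT.fst).succ (.and
    (.forall_lt (hm.comp p2) (.imp (.ne PT.snd (hY.comp p3)) (.le hs (PT.succ ?_))))
    (.forall_lt (hm.comp p2) (.bool (.getD ?_ PT.snd)))))))
  · exact .countOthers (hW.comp p3) (hJ.comp p3) (hY.comp p3) PT.snd
  · exact .placedCode (hW.comp p3) (hJ.comp p3) hx (hY.comp p3) hs (hm.comp p3)

theorem PTP.wellFormed (hW : PT W) : PTP fun a => WellFormed (W a) := by
  have hn : PT fun a => PossibleManipulators.entry (W a) 1 := hW.entry (.const_nat 1)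
  have hm : PT fun a => PossibleManipulators.entry (W a) 0 := hW.entry (.const_nat 0)
  have p2 : PT fun x : (α × ℕ) × ℕ => x.1.1 := PT.fst.comp PT.fst
  have p3 : PT fun x : ((α × ℕ) × ℕ) × ℕ => x.1.1.1 := p2.comp PT.fst
  have hi : PT fun x : ((α × ℕ) × ℕ) × ℕ => x.1.1.2 := PT.snd.comp (PT.fst.comp PT.fst)
  refine .and ((PTP.bool hW.foldl_last).not.congr fun a => by simp) (.and (.lt (.const_nat 0) hm)
    (.and (.lt (.const_nat 0) hn) (.forall_lt hn.succ (.forall_lt (hm.comp PT.fst) (.and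
    (.lt ?_ (hm.comp p2)) (.forall_lt PT.snd (.ne ?_ ?_)))))))
  · exact .ballot (hW.comp p2) (PT.snd.comp PT.fst) PT.snd
  · exact .ballot (hW.comp p3) hi PT.snd
  · exact .ballot (hW.comp p3) hi (PT.snd.comp PT.fst)

theorem PT.codeLength (hW : PT W) : PT fun a => codeLength (W a) :=
  (const_nat 2).add ((hW.entry (const_nat 1)).succ.mul (hW.entry (const_nat 0)))

end PolyTime

end PossibleManipulators

namespace PossibleManipulators

/-! ### Encodings of elections -/

theorem getD_flatten_ofFn {n m : ℕ} (g : Fin n → Fin m → ℕ) (s : List ℕ) (i : Fin n) (j : Fin m) :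
    ((List.ofFn fun i => List.ofFn (g i)).flatten ++ s).getD (i * m + j) 0 = g i j := by
  induction n with
  | zero => exact i.elim0
  | succ n ih =>
    rw [List.ofFn_succ, List.flatten_cons, List.append_assoc]
    refine Fin.cases ?_ (fun i => ?_) i
    · rw [List.getD_append _ _ _ _ (by simp), List.getD_eq_getElem _ _ (by simp)]
      simp
    · rw [List.getD_append_right _ _ _ _ (by simp [Nat.add_mul]; omega), ← ih (fun i => g i.succ)]
      congr 1
      simp [Nat.add_mul]
      omega

namespace Election

variable (E : Election) (s : List ℕ)

theorem length_code : E.code.length = 2 + (E.n + 1) * E.m := by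
  simp [code, Vote.code, List.length_flatten, List.map_ofFn, Function.comp_def, Nat.add_mul]
  ring

/-- The summand `0 * E.m` matches the index that `ballot` uses for the ballot 0. -/
theorem getD_code_tie (p : Fin E.m) : (E.code ++ s).getD (2 + 0 * E.m + p) 0 = E.tie p := by
  simp only [code, List.append_assoc]
  rw [List.getD_append_right _ _ _ _ (by simp), List.getD_append _ _ _ _ (by simp [Vote.code]),
    List.getD_eq_getElem _ _ (by simp [Vote.code])]
  simp [Vote.code]

theorem getD_code_votes (i : Fin E.n) (p : Fin E.m) :
    (E.code ++ s).getD (2 + (i + 1) * E.m + p) 0 = E.votes i p := by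
  simp only [code, List.append_assoc]
  rw [List.getD_append_right _ _ _ _ (by simp; omega),
    List.getD_append_right _ _ _ _ (by simp [Vote.code, Nat.add_mul]; omega),
    ← getD_flatten_ofFn (fun i p => (E.votes i p : ℕ)) s i p]
  congr 1
  simp [Vote.code, Nat.add_mul]
  omega

theorem getD_code_right (i : ℕ) :
    (E.code ++ s).getD (2 + (E.n + 1) * E.m + i) 0 = s.getD i 0 := by
  rw [List.getD_append_right _ _ _ _ (by rw [length_code]; omega), length_code,
    Nat.add_sub_cancel_left]

end Election

/-- `w` encodes a list of numbers that starts with the code of the election `E`. -/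
structure Describes (w : List Bool) (E : Election) : Prop where
  entry_zero : entry w 0 = E.m
  entry_one : entry w 1 = E.n
  ballot_tie (p : Fin E.m) : ballot w 0 p = E.tie p
  ballot_votes (i : Fin E.n) (p : Fin E.m) : ballot w (i + 1) p = E.votes i p

theorem describes_encodeNats (E : Election) (s : List ℕ) :
    Describes (encodeNats (E.code ++ s)) E := by
  have h : entry (encodeNats (E.code ++ s)) 0 = E.m := by
    rw [entry_encodeNats]
    rfl
  refine ⟨h, ?_, fun p => ?_, fun i p => ?_⟩
  · rw [entry_encodeNats]
    rfl
  · rw [ballot, h, entry_encodeNats, E.getD_code_tie]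
  · rw [ballot, h, entry_encodeNats, E.getD_code_votes]

theorem codeLength_encodeNats (E : Election) (s : List ℕ) :
    codeLength (encodeNats (E.code ++ s)) = 2 + (E.n + 1) * E.m := by
  have h := describes_encodeNats E s
  rw [codeLength, h.entry_zero, h.entry_one]

theorem entry_codeLength_add (E : Election) (s : List ℕ) (i : ℕ) :
    entry (encodeNats (E.code ++ s)) (codeLength (encodeNats (E.code ++ s)) + i) = s.getD i 0 := by
  rw [codeLength_encodeNats, entry_encodeNats, E.getD_code_right]

theorem wellFormed_encodeNats (E : Election) (s : List ℕ) :
    WellFormed (encodeNats (E.code ++ s)) := by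
  have h := describes_encodeNats E s
  refine ⟨(exists_encodeNats_eq_iff _).1 ⟨_, rfl⟩, ?_, ?_, ?_⟩
  · rw [h.entry_zero]
    exact Nat.pos_of_neZero _
  · rw [h.entry_one]
    exact Nat.pos_of_neZero _
  · rw [h.entry_zero, h.entry_one]
    have key : ∀ i < E.n + 1, ∃ v : Vote E.m, ∀ p : Fin E.m,
        ballot (encodeNats (E.code ++ s)) i p = v p := by
      rintro (_ | i) hi
      · exact ⟨_, h.ballot_tie⟩
      · exact ⟨_, h.ballot_votes ⟨i, by omega⟩⟩
    intro i hi p hp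
    obtain ⟨v, hv⟩ := key i hi
    have hvp := hv ⟨p, hp⟩
    simp only at hvp
    rw [hvp]
    refine ⟨Fin.is_lt _, fun q hq e => ?_⟩
    have hvq := hv ⟨q, hq.trans hp⟩
    simp only at hvq
    rw [hvq] at e
    have := congrArg Fin.val (v.injective (Fin.ext e))
    simp only at this
    omega

/-- A ballot without repetitions is an injective self-map of a finite set, hence a permutation. The
length condition is needed because missing numbers are read as 0 and could pass for candidates. -/
theorem WellFormed.exists_election {w : List Bool} (h : WellFormed w)
    (hw : codeLength w ≤ w.count false) :
    ∃ (E : Election) (s : List ℕ), encodeNats (E.code ++ s) = w := by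
  obtain ⟨h0, hm, hn, hb⟩ := h
  obtain ⟨l, rfl⟩ := (exists_encodeNats_eq_iff w).2 h0
  rw [count_encodeNats, codeLength] at hw
  have key : ∀ i < entry (encodeNats l) 1 + 1, ∃ v : Vote (entry (encodeNats l) 0),
      ∀ p : Fin (entry (encodeNats l) 0), ballot (encodeNats l) i p = v p := by
    intro i hi
    refine ⟨Equiv.ofBijective (fun p => ⟨ballot (encodeNats l) i p, (hb i hi p p.2).1⟩)
      (Finite.injective_iff_bijective.1 fun p q e => ?_), fun p => rfl⟩
    have e' : ballot (encodeNats l) i p = ballot (encodeNats l) i q := congrArg Fin.val e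
    rcases lt_trichotomy (p : ℕ) q with h | h | h
    · exact absurd e' ((hb i hi q q.2).2 p h)
    · exact Fin.ext h
    · exact absurd e'.symm ((hb i hi p p.2).2 q h)
  choose v hv using key
  have : NeZero (entry (encodeNats l) 0) := ⟨hm.ne'⟩
  have : NeZero (entry (encodeNats l) 1) := ⟨hn.ne'⟩
  let E : Election := ⟨entry (encodeNats l) 0, entry (encodeNats l) 1, v 0 (by omega),
    fun i => v (i + 1) (by omega)⟩
  refine ⟨E, l.drop E.code.length, congrArg encodeNats ?_⟩
  suffices h : l.take E.code.length = E.code by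
    conv_rhs => rw [← List.take_append_drop E.code.length l, h]
  have hl : E.code.length = 2 + (entry (encodeNats l) 1 + 1) * entry (encodeNats l) 0 :=
    E.length_code
  have hlen : (l.take E.code.length).length = E.code.length := by
    rw [List.length_take]
    omega
  refine List.ext_getElem hlen fun k h1 h2 => ?_
  suffices h : l.getD k 0 = E.code.getD k 0 by
    rw [List.getD_eq_getElem _ _ (by omega), List.getD_eq_getElem _ _ h2] at h
    rw [List.getElem_take, h]
  rcases k with _ | _ | k
  · exact (entry_encodeNats l 0).symm
  · exact (entry_encodeNats l 1).symm
  · have hk : k < (entry (encodeNats l) 1 + 1) * entry (encodeNats l) 0 := by omega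
    have hp := Nat.mod_lt k hm
    have hi : k / entry (encodeNats l) 0 < entry (encodeNats l) 1 + 1 :=
      (Nat.div_lt_iff_lt_mul hm).2 hk
    -- After the two header numbers, the quotient by `m` is the ballot number and the remainder is
    -- the position.
    have e : k + 1 + 1 = 2 + k / entry (encodeNats l) 0 * entry (encodeNats l) 0 +
        k % entry (encodeNats l) 0 := by
      have := Nat.div_add_mod' k (entry (encodeNats l) 0)
      omega
    have h3 := hv _ hi ⟨_, hp⟩
    rw [ballot, entry_encodeNats] at h3
    rw [e, h3]
    generalize k % entry (encodeNats l) 0 = p at *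
    generalize k / entry (encodeNats l) 0 = i at *
    rw [← List.append_nil E.code]
    rcases i with _ | i
    · exact (E.getD_code_tie [] ⟨p, hp⟩).symm
    · exact (E.getD_code_votes [] ⟨i, by simpa using hi⟩ ⟨p, hp⟩).symm

/-! ### Correctness of the algorithm -/

theorem count_eq_card {p : ℕ → Prop} [DecidablePred p] (n : ℕ) :
    Nat.count p n = (Finset.univ.filter fun i : Fin n => p i).card := by
  rw [Nat.count_eq_card_filter_range, ← Nat.Iio_eq_range, ← Fin.map_valEmbedding_univ,
    Finset.filter_map, Finset.card_map]
  rfl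

theorem pref_iff {m : ℕ} {w : List Bool} {i : ℕ} (hm : entry w 0 = m) {v : Vote m}
    (h : ∀ p : Fin m, ballot w i p = v p) (a b : Fin m) : Pref w i a b ↔ v.Prefers a b := by
  rw [Pref, hm]
  constructor
  · rintro ⟨p, hp, q, hq, e1, e2⟩
    have e1' : v ⟨q, hq.trans hp⟩ = a := Fin.ext (by rw [← h]; exact e1)
    have e2' : v ⟨p, hp⟩ = b := Fin.ext (by rw [← h]; exact e2)
    rw [Vote.Prefers, ← e1', ← e2', Equiv.symm_apply_apply, Equiv.symm_apply_apply]
    exact hq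
  · intro hv
    refine ⟨v.symm b, Fin.is_lt _, v.symm a, hv, ?_, ?_⟩
    · rw [h, Equiv.apply_symm_apply]
    · rw [h, Equiv.apply_symm_apply]

namespace Describes

variable {w : List Bool} {E : Election}

theorem countOthers_eq (h : Describes w E) (j : Fin E.n) (a b : Fin E.m) :
    countOthers w j a b = numOthers E.votes j a b := by
  classical
  rw [countOthers, h.entry_one, count_eq_card, numOthers]
  refine congrArg Finset.card (Finset.filter_congr fun i _ => ?_)
  rw [pref_iff h.entry_zero (h.ballot_votes i), ne_eq, Fin.val_inj]

/-- Voters are numbered below `n`, so excluding the number `n` excludes nobody. -/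
theorem countOthers_entry_one (h : Describes w E) (a b : Fin E.m) :
    countOthers w (entry w 1) a b = numPrefer E.votes a b := by
  classical
  rw [countOthers, h.entry_one, count_eq_card, numPrefer]
  refine congrArg Finset.card (Finset.filter_congr fun i _ => ?_)
  rw [pref_iff h.entry_zero (h.ballot_votes i)]
  exact and_iff_right i.2.ne

theorem tieBit_eq (h : Describes w E) (a b : Fin E.m) :
    tieBit w a b = if E.tie.Prefers a b then 1 else 0 := by
  classical
  rw [tieBit]
  exact if_congr (pref_iff h.entry_zero h.ballot_tie a b) rfl rfl

theorem forall_candidate_iff (h : Describes w E) {p : ℕ → Prop} :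
    (∀ a < entry w 0, p a) ↔ ∀ a : Fin E.m, p a := by
  rw [h.entry_zero, Fin.forall_iff]

theorem exists_candidate_iff (h : Describes w E) {p : ℕ → Prop} :
    (∃ a < entry w 0, p a) ↔ ∃ a : Fin E.m, p a := by
  rw [h.entry_zero, Fin.exists_iff]
  simp only [exists_prop]

theorem isWinner_iff (h : Describes w E) (x : Fin E.m) :
    IsWinner w x ↔ winner maximin E.tie E.votes = x := by
  simp only [IsWinner, winner_maximin_eq_iff, h.forall_candidate_iff, h.exists_candidate_iff,
    h.countOthers_entry_one, h.tieBit_eq, ne_eq, Fin.val_inj]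

/-- Round 0 is the empty list, whose entries all default to `false`, in agreement with the empty
set. -/
theorem placedCode_iff (h : Describes w E) (j : Fin E.n) (x y : Fin E.m) (s k : ℕ) (a : Fin E.m) :
    (placedCode w j x y s k).getD a false = true ↔ a ∈ placed (numOthers E.votes j) x y s
      (fun b => s + if E.tie.Prefers y b then 1 else 0) k := by
  classical
  induction k generalizing a with
  | zero => simp [placedCode, placed]
  | succ k ih =>
    have ha : (a : ℕ) < entry w 0 := by
      rw [h.entry_zero]
      exact a.2
    rw [placedCode, Function.iterate_succ_apply', ← placedCode,
      List.getD_eq_getElem _ _ (by simpa using ha), List.getElem_map, List.getElem_range,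
      decide_eq_true_iff]
    simp only [PlaceableCode, h.exists_candidate_iff, h.countOthers_eq, h.tieBit_eq, ih, ne_eq,
      Fin.val_inj]
    rfl

theorem manip_iff (h : Describes w E) (j : Fin E.n) (y : Fin E.m) :
    Manip w j y ↔ IsCoalitionAgainst (E.winner maximin) E.votes {j} y := by
  refine Iff.trans ?_ (isCoalitionAgainst_singleton_iff E.tie E.votes j y).symm
  simp only [Manip, h.exists_candidate_iff, h.forall_candidate_iff, h.isWinner_iff,
    h.countOthers_eq, h.placedCode_iff, ne_eq, Fin.val_inj, h.entry_one]
  rw [h.entry_zero]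

end Describes

/-! ### The four problems -/

theorem languageInP_of_ptp {L : Language Bool} {Q : List Bool → Prop} (hQ : PTP Q)
    (h : ∀ w, w ∈ L ↔ Q w) : LanguageInP L := by
  classical
  exact (hQ.congr fun w => (h w).symm).decide.tm2ComputableInPolyTime

/-- `w` encodes a list of numbers that consists of the code of an election and `k` more numbers. -/
def IsCode (w : List Bool) (k : ℕ) : Prop := WellFormed w ∧ w.count false = codeLength w + k

/-- Each number contributes exactly one `false`, so counting these bits gives the length of the
list. -/
theorem isCode_iff (w : List Bool) (k : ℕ) :
    IsCode w k ↔ ∃ (E : Election) (s : List ℕ), s.length = k ∧ encodeNats (E.code ++ s) = w := by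
  constructor
  · rintro ⟨h, h'⟩
    obtain ⟨E, s, rfl⟩ := h.exists_election (by omega)
    refine ⟨E, s, ?_, rfl⟩
    rw [count_encodeNats, codeLength_encodeNats, List.length_append, E.length_code] at h'
    omega
  · rintro ⟨E, s, rfl, rfl⟩
    refine ⟨wellFormed_encodeNats E s, ?_⟩
    rw [count_encodeNats, codeLength_encodeNats, List.length_append, E.length_code]

/-- The number with index `i` after the code of the election. -/
def param (w : List Bool) (i : ℕ) : ℕ := entry w (codeLength w + i)

/-- The coalition encoded after the code of the election consists of the voter `j`. -/
def IsSingletonCode (w : List Bool) (j : ℕ) : Prop :=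
  ∀ i < entry w 1, (i = j → param w i = 1) ∧ (i ≠ j → param w i = 0)

section PolyTime

variable {α : Type} [Dat α] {W : α → List Bool} {I J K : α → ℕ}

theorem PT.param (hW : PT W) (hI : PT I) : PT fun a => param (W a) (I a) :=
  hW.entry (hW.codeLength.add hI)

theorem PTP.isCode (hW : PT W) (hK : PT K) : PTP fun a => IsCode (W a) (K a) :=
  .and (.wellFormed hW) (.eq hW.count_false (hW.codeLength.add hK))

theorem PTP.isSingletonCode (hW : PT W) (hJ : PT J) : PTP fun a => IsSingletonCode (W a) (J a) := by
  have hp : PT fun x : α × ℕ => PossibleManipulators.param (W x.1) x.2 :=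
    .param (hW.comp PT.fst) PT.snd
  have hj : PT fun x : α × ℕ => J x.1 := hJ.comp PT.fst
  exact .forall_lt (hW.entry (.const_nat 1)) (.and (.imp (.eq PT.snd hj) (.eq hp (.const_nat 1)))
    (.imp (.ne PT.snd hj) (.eq hp (.const_nat 0))))

end PolyTime

theorem eq_of_getD_eq {l l' : List ℕ} (h : l.length = l'.length)
    (h' : ∀ i < l.length, l.getD i 0 = l'.getD i 0) : l = l' := by
  refine List.ext_getElem h fun i h1 h2 => ?_
  have := h' i h1
  rwa [List.getD_eq_getElem _ _ h1, List.getD_eq_getElem _ _ h2] at this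

theorem param_encodeNats (E : Election) (s : List ℕ) (i : ℕ) :
    param (encodeNats (E.code ++ s)) i = s.getD i 0 := entry_codeLength_add E s i

theorem length_coalitionCode {n : ℕ} (M : Finset (Fin n)) : (coalitionCode M).length = n := by
  simp [coalitionCode]

theorem getD_coalitionCode_singleton {n : ℕ} (j : Fin n) (i : ℕ) (hi : i < n) (s : List ℕ) :
    (coalitionCode {j} ++ s).getD i 0 = if i = j then 1 else 0 := by
  rw [List.getD_append _ _ _ _ (by rwa [length_coalitionCode]),
    List.getD_eq_getElem _ _ (by rwa [length_coalitionCode])]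
  simp [coalitionCode, Fin.ext_iff]

/-- The test fixes the first `E.n` parameters and says nothing about those after them, which remain
as `s.drop E.n`. -/
theorem isSingletonCode_iff (E : Election) (s : List ℕ) (hs : E.n ≤ s.length) (j : Fin E.n) :
    IsSingletonCode (encodeNats (E.code ++ s)) j ↔ s = coalitionCode {j} ++ s.drop E.n := by
  simp only [IsSingletonCode, param_encodeNats, (describes_encodeNats E s).entry_one]
  constructor
  · intro h
    suffices h : s.take E.n = coalitionCode {j} by
      rw [← h, List.take_append_drop]
    have hl : (s.take E.n).length = E.n := by
      rw [List.length_take]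
      omega
    refine eq_of_getD_eq (by rw [hl, length_coalitionCode]) fun i hi => ?_
    rw [hl] at hi
    have h1 := getD_coalitionCode_singleton j i hi []
    rw [List.append_nil] at h1
    have h2 : (s.take E.n).getD i 0 = s.getD i 0 := by
      rw [List.getD_eq_getElem _ _ (by omega), List.getD_eq_getElem _ _ (by omega),
        List.getElem_take]
    rw [h1, h2]
    split_ifs with e
    · exact (h i hi).1 e
    · exact (h i hi).2 e
  · intro h i hi
    rw [h, getD_coalitionCode_singleton j i hi]
    exact ⟨fun e => if_pos e, fun e => if_neg e⟩

theorem cpmw_inP :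
    ((CPMW maximin).restrict fun I : CPMWInstance => I.M.card = 1).InP := by
  have hn : PT fun w : List Bool => entry w 1 := PT.id.entry (.const_nat 1)
  have hy : PT fun w : List Bool => param w (entry w 1) := PT.id.param hn
  -- The parameters are the `n` bits of the indicator vector and then `y`, which has index `n`. The
  -- test must also check that `y` is a candidate and that the vector has exactly one 1.
  refine languageInP_of_ptp (Q := fun w => IsCode w (entry w 1 + 1) ∧
    param w (entry w 1) < entry w 0 ∧
    ∃ j < entry w 1, IsSingletonCode w j ∧ Manip w j (param w (entry w 1)))
    (.and (.isCode PT.id hn.succ) (.and (.lt hy (PT.id.entry (.const_nat 0)))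
    (.exists_lt hn (.and (.isSingletonCode PT.fst PT.snd)
    (.manip PT.fst PT.snd (hy.comp PT.fst)))))) fun w => ?_
  rw [isCode_iff]
  constructor
  · rintro ⟨⟨⟨E, M, y⟩, hM⟩, hI, rfl⟩
    obtain ⟨j, rfl⟩ : ∃ j, M = {j} := Finset.card_eq_one.1 hM
    have h := describes_encodeNats E (coalitionCode {j} ++ [(y : ℕ)])
    have hp : param (encodeNats (E.code ++ (coalitionCode {j} ++ [(y : ℕ)]))) E.n = y := by
      rw [param_encodeNats, List.getD_append_right _ _ _ _ (by rw [length_coalitionCode]),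
        length_coalitionCode]
      simp
    simp only [DecisionProblem.restrict, CPMW]
    rw [h.entry_one, h.entry_zero, hp]
    refine ⟨⟨E, _, by simp [length_coalitionCode], rfl⟩, y.2, j, j.2, ?_, (h.manip_iff j y).2 hI⟩
    rw [isSingletonCode_iff _ _ (by simp [length_coalitionCode])]
    congr 1
    rw [List.drop_left' (length_coalitionCode _)]
  · rintro ⟨⟨E, s, hs, rfl⟩, hy, j, hj, hM, h⟩
    have hd := describes_encodeNats E s
    rw [hd.entry_one] at hs hy hj h
    rw [hd.entry_zero] at hy
    lift j to Fin E.n using hj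
    rw [isSingletonCode_iff _ _ (by omega)] at hM
    have e : s.drop E.n = [param (encodeNats (E.code ++ s)) E.n] := by
      rw [param_encodeNats, List.drop_eq_getElem_cons (by omega), List.drop_eq_nil_of_le (by omega),
        List.getD_eq_getElem _ _ (by omega)]
    refine ⟨⟨⟨E, {j}, ⟨_, hy⟩⟩, Finset.card_singleton j⟩, (hd.manip_iff j ⟨_, hy⟩).1 h, ?_⟩
    rw [e] at hM
    exact congrArg (fun t => encodeNats (E.code ++ t)) hM.symm

theorem cpm_inP : ((CPM maximin).restrict fun I : CPMInstance => I.M.card = 1).InP := by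
  have hn : PT fun w : List Bool => entry w 1 := PT.id.entry (.const_nat 1)
  have hm : PT fun w : List Bool => entry w 0 := PT.id.entry (.const_nat 0)
  refine languageInP_of_ptp (Q := fun w => IsCode w (entry w 1) ∧
    ∃ j < entry w 1, IsSingletonCode w j ∧ ∃ y < entry w 0, Manip w j y)
    (.and (.isCode PT.id hn) (.exists_lt hn (.and (.isSingletonCode PT.fst PT.snd)
    (.exists_lt (hm.comp PT.fst) (.manip (PT.fst.comp PT.fst) (PT.snd.comp PT.fst) PT.snd)))))
    fun w => ?_
  rw [isCode_iff]
  constructor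
  · rintro ⟨⟨⟨E, M⟩, hM⟩, ⟨y, hI⟩, rfl⟩
    obtain ⟨j, rfl⟩ : ∃ j, M = {j} := Finset.card_eq_one.1 hM
    have h := describes_encodeNats E (coalitionCode {j})
    simp only [DecisionProblem.restrict, CPM]
    rw [h.entry_one, h.entry_zero]
    refine ⟨⟨E, _, by simp [length_coalitionCode], rfl⟩, j, j.2, ?_, y, y.2,
      (h.manip_iff j y).2 hI⟩
    rw [isSingletonCode_iff _ _ (by simp [length_coalitionCode]),
      List.drop_eq_nil_of_le (by simp [length_coalitionCode]), List.append_nil]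
  · rintro ⟨⟨E, s, hs, rfl⟩, j, hj, hM, y, hy, h⟩
    have hd := describes_encodeNats E s
    rw [hd.entry_one] at hs hj
    rw [hd.entry_zero] at hy
    lift j to Fin E.n using hj
    rw [isSingletonCode_iff _ _ (by omega), List.drop_eq_nil_of_le (by omega),
      List.append_nil] at hM
    exact ⟨⟨⟨E, {j}⟩, Finset.card_singleton j⟩, ⟨⟨y, hy⟩, (hd.manip_iff j ⟨y, hy⟩).1 h⟩,
      congrArg (fun t => encodeNats (E.code ++ t)) hM.symm⟩

theorem cpmsw_inP : ((CPMSW maximin).restrict fun I : CPMSWInstance => I.k = 1).InP := by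
  have hn : PT fun w : List Bool => entry w 1 := PT.id.entry (.const_nat 1)
  have hy : PT fun w : List Bool => param w 0 := PT.id.param (.const_nat 0)
  -- Two parameters follow the election, `y` and `k`; the restriction to `k = 1` becomes a test of
  -- the second one.
  refine languageInP_of_ptp (Q := fun w => IsCode w 2 ∧ param w 0 < entry w 0 ∧ param w 1 = 1 ∧
    ∃ j < entry w 1, Manip w j (param w 0))
    (.and (.isCode PT.id (.const_nat 2)) (.and (.lt hy (PT.id.entry (.const_nat 0)))
    (.and (.eq (PT.id.param (.const_nat 1)) (.const_nat 1)) (.exists_lt hn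
    (.manip PT.fst PT.snd (hy.comp PT.fst)))))) fun w => ?_
  rw [isCode_iff]
  constructor
  · rintro ⟨⟨⟨E, y, k⟩, hk⟩, hI, rfl⟩
    obtain rfl : k = 1 := hk
    obtain ⟨j, hj⟩ := (exists_isCoalitionAgainst_iff _ _ _).1 hI
    have h := describes_encodeNats E [(y : ℕ), 1]
    simp only [DecisionProblem.restrict, CPMSW]
    rw [h.entry_one, h.entry_zero, param_encodeNats, param_encodeNats]
    exact ⟨⟨E, _, rfl, rfl⟩, y.2, rfl, j, j.2, (h.manip_iff j y).2 hj⟩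
  · rintro ⟨⟨E, s, hs, rfl⟩, hy, hk, j, hj, h⟩
    obtain ⟨y, k, rfl⟩ := List.length_eq_two.1 hs
    have hd := describes_encodeNats E [y, k]
    rw [hd.entry_one] at hj
    rw [param_encodeNats] at hk hy h
    rw [hd.entry_zero] at hy
    obtain rfl : k = 1 := hk
    change y < E.m at hy
    exact ⟨⟨⟨E, ⟨y, hy⟩, 1⟩, rfl⟩, (exists_isCoalitionAgainst_iff _ _ _).2
      ⟨⟨j, hj⟩, (hd.manip_iff ⟨j, hj⟩ ⟨y, hy⟩).1 h⟩, rfl⟩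

theorem cpms_inP : ((CPMS maximin).restrict fun I : CPMSInstance => I.k = 1).InP := by
  have hn : PT fun w : List Bool => entry w 1 := PT.id.entry (.const_nat 1)
  have hm : PT fun w : List Bool => entry w 0 := PT.id.entry (.const_nat 0)
  refine languageInP_of_ptp (Q := fun w => IsCode w 1 ∧ param w 0 = 1 ∧
    ∃ j < entry w 1, ∃ y < entry w 0, Manip w j y)
    (.and (.isCode PT.id (.const_nat 1)) (.and
    (.eq (PT.id.param (.const_nat 0)) (.const_nat 1)) (.exists_lt hn
    (.exists_lt (hm.comp PT.fst) (.manip (PT.fst.comp PT.fst) (PT.snd.comp PT.fst) PT.snd)))))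
    fun w => ?_
  rw [isCode_iff]
  constructor
  · rintro ⟨⟨⟨E, k⟩, hk⟩, ⟨M, hM, y, hI⟩, rfl⟩
    obtain rfl : k = 1 := hk
    obtain ⟨j, hj⟩ := (exists_isCoalitionAgainst_iff _ _ _).1 ⟨M, hM, hI⟩
    have h := describes_encodeNats E [1]
    simp only [DecisionProblem.restrict, CPMS]
    rw [h.entry_one, h.entry_zero, param_encodeNats]
    exact ⟨⟨E, _, rfl, rfl⟩, rfl, j, j.2, y, y.2, (h.manip_iff j y).2 hj⟩
  · rintro ⟨⟨E, s, hs, rfl⟩, hk, j, hj, y, hy, h⟩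
    obtain ⟨k, rfl⟩ := List.length_eq_one_iff.1 hs
    have hd := describes_encodeNats E [k]
    rw [hd.entry_one] at hj
    rw [hd.entry_zero] at hy
    rw [param_encodeNats] at hk
    obtain rfl : k = 1 := hk
    obtain ⟨M, hM, hI⟩ := (exists_isCoalitionAgainst_iff _ _ _).2
      ⟨⟨j, hj⟩, (hd.manip_iff ⟨j, hj⟩ ⟨y, hy⟩).1 h⟩
    exact ⟨⟨⟨E, 1⟩, rfl⟩, ⟨M, hM, _, hI⟩, rfl⟩

end PossibleManipulators

open PossibleManipulators in
theorem mainTheorem5 :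
    ((CPMW maximin).restrict fun I : CPMWInstance => I.M.card = 1).InP ∧
    ((CPM maximin).restrict fun I : CPMInstance => I.M.card = 1).InP ∧
    ((CPMSW maximin).restrict fun I : CPMSWInstance => I.k = 1).InP ∧
    ((CPMS maximin).restrict fun I : CPMSInstance => I.k = 1).InP :=
  ⟨cpmw_inP, cpm_inP, cpmsw_inP, cpms_inP⟩
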